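/- **Definitions.** Let $Q$ be a convex polytope of dimension $d$ and let $f_i(Q)$ be the number of its $i$-dimensional faces. Put $F(Q)(\alpha,t)=\sum_{i=0}^{d} f_i(Q)\,\alpha^{i}t^{d-i}$ and $H(Q)(\alpha,t)=F(Q)(\alpha-t,t)$. A polynomial $\gamma(Q)(\tau)=\sum_{i=0}^{\lfloor d/2\rfloor}\gamma_i\tau^i$ is the $\gamma$-polynomial of $Q$ if $H(Q)(\alpha,t)=\sum_{i=0}^{\lfloor d/2\rfloor}\gamma_i(\alpha t)^i(\alpha+t)^{d-2i}$ (such a polynomial is unique, and it exists if $Q$ is simple). For a finite simplicial complex $K$ with $f_i$ simplices of dimension $i$, the $f$-polynomial is $f(K)(\tau)=1+f_0\tau+f_1\tau^2+\cdots$; the complex $K$ is flag if every clique of its $1$-skeleton is a simplex. For a simple $n$-dimensional polytope $P$, let $\partial P^*$ be the simplicial complex whose simplices $\sigma_Q$ (including the empty one, $\sigma_P=\varnothing$) correspond to the nonempty faces $Q$ of $P$ with inclusions reversed. A simple $n$-polytope $\tilde P$ is obtained from $P$ by $2$-truncation of a face $G$ of codimension $2$ if $\partial\tilde P^*$ is the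 stellar subdivision of $\partial P^*$ along $\sigma_G$; the new vertex $v$ corresponds to the section facet of $\tilde P$. A $2$-truncated cube is a polytope obtained from a polytope combinatorially equivalent to $[0,1]^n$ by a finite sequence of $2$-truncations. **Construction.** Let $P$ be obtained from a cube by a sequence of $m$ $2$-truncations. Define simplicial complexes $\Delta(Q)$ for all nonempty faces $Q$ of $P$ (including $Q=P$), with vertices in $\{w_1,\dots,w_m\}$, as follows. If $m=0$, every $\Delta(Q)$ is the complex without vertices. If $\tilde P$ is obtained from $P$ by the $m$-th $2$-truncation, of the face $G$, and $\tilde Q$ is a face of $\tilde P$, let $Q$ be the face of $P$ with $\sigma_Q=\sigma_{\tilde Q}$ if $v\notin\sigma_{\tilde Q}$, and with $\sigma_Q=(\sigma_{\tilde Q}\setminus\{v\})\cup\sigma_G$ if $v\in\sigma_{\tilde Q}$. Then $$\Delta(\tilde Q)=\begin{cases}\Delta(Q)\cup\bigl(\Delta(G\cap Q)\star w_m\bigr)&\text{if } G\cap Q\text{ is a nonempty face of codimension } 2 \text{ of } Q,\\ \Delta(Q)&\text{otherwise.}\end{cases}$$ **Theorem.** For every $2$-truncated cube $P$ there is a finite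 flag simplicial complex $\Delta$ with $f(\Delta)=\gamma(P)$. More precisely, for every sequence of $m$ $2$-truncations leading from a cube to $P$ and for every nonempty face $Q$ of $P$ (including $Q=P$), the complex $\Delta(Q)$ of the construction has all its vertices in $\{w_1,\dots,w_m\}$, is flag, and satisfies $f(\Delta(Q))=\gamma(Q)$. -/

import Mathlib

noncomputable section

namespace TwoTruncatedCube

variable {E : Type*} [NormedAddCommGroup E] [NormedSpace ℝ E]

/-! ### Convex polytopes, faces, and the polynomials `F`, `H`, `γ` -/

/-- The dimension of a convex set: the dimension of its affine hull. -/
def dim (A : Set E) : ℕ := Module.finrank ℝ (vectorSpan ℝ A)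

/-- A convex polytope of dimension `n` in the real vector space `E`. -/
structure ConvexPolytope (E : Type*) [NormedAddCommGroup E] [NormedSpace ℝ E] (n : ℕ) where
  carrier : Set E
  isHull : ∃ S : Finset E, S.Nonempty ∧ carrier = convexHull ℝ (S : Set E)
  dim_eq : dim carrier = n

/-- The nonempty faces of `A` (the sets where some linear functional attains its maximum on `A`;
the zero functional gives `A` itself), ordered by inclusion. -/
abbrev Face (A : Set E) : Type _ := {B : Set E // B.Nonempty ∧ IsExposed ℝ A B}

/-- The intersection of two faces that meet is a face. -/
def Face.inter {A : Set E} (B C : Face A) (h : (B.1 ∩ C.1).Nonempty) : Face A :=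
  ⟨B.1 ∩ C.1, h, B.2.2.inter C.2.2⟩

/-- The number of `i`-dimensional faces. -/
def faceNumber (A : Set E) (i : ℕ) : ℕ := Nat.card {B : Face A // dim B.1 = i}

/-- `F(α, t) = ∑ f_i α ^ i t ^ (d - i)`, where `d` is the dimension; `α` is the variable `X 0` and
`t` is the variable `X 1`. -/
def FPolynomial (A : Set E) : MvPolynomial (Fin 2) ℤ :=
  ∑ i ∈ Finset.range (dim A + 1),
    MvPolynomial.C (faceNumber A i : ℤ) * MvPolynomial.X 0 ^ i * MvPolynomial.X 1 ^ (dim A - i)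

/-- `H(α, t) = F(α - t, t)`. -/
def HPolynomial (A : Set E) : MvPolynomial (Fin 2) ℤ :=
  MvPolynomial.bind₁ ![MvPolynomial.X 0 - MvPolynomial.X 1, MvPolynomial.X 1] (FPolynomial A)

/-- `g` is the `γ`-polynomial of `A`: its degree is at most `⌊d / 2⌋` and
`H(α, t) = ∑ γ_i (α t) ^ i (α + t) ^ (d - 2 i)`, where `γ_i` is the coefficient of `g` at `i`. -/
def IsGammaPolynomial (A : Set E) (g : Polynomial ℤ) : Prop :=
  g.natDegree ≤ dim A / 2 ∧
  HPolynomial A = ∑ i ∈ Finset.range (dim A / 2 + 1),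
    MvPolynomial.C (g.coeff i) * (MvPolynomial.X 0 * MvPolynomial.X 1) ^ i *
      (MvPolynomial.X 0 + MvPolynomial.X 1) ^ (dim A - 2 * i)

/-! ### Abstract simplicial complexes

The faces of a `PreAbstractSimplicialComplex` are its nonempty simplices. -/

/-- The simplices of a complex, the empty one included, ordered by inclusion. -/
abbrev Simplex {V : Type*} (K : PreAbstractSimplicialComplex V) : Type _ :=
  {s : Finset V // s = ∅ ∨ s ∈ K.faces}

/-- Every clique of the 1-skeleton forms a simplex. -/
def IsFlag {V : Type*} [DecidableEq V] (K : PreAbstractSimplicialComplex V) : Prop :=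
  ∀ s : Finset V, s.Nonempty → (∀ v ∈ s, {v} ∈ K.faces) →
    (∀ u ∈ s, ∀ v ∈ s, u ≠ v → {u, v} ∈ K.faces) → s ∈ K.faces

/-- `f(K) = 1 + f_0 t + f_1 t ^ 2 + ...` for a finite complex `K`. -/
def fPolynomial {V : Type*} (K : PreAbstractSimplicialComplex V) : Polynomial ℤ :=
  1 + ∑ᶠ s ∈ K.faces, Polynomial.X ^ s.card

/-- The cone `K ⋆ w`. -/
def cone {V : Type*} [DecidableEq V] (K : PreAbstractSimplicialComplex V) (w : V) :
    PreAbstractSimplicialComplex V where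
  faces := K.faces ∪ {s | w ∈ s ∧ (s.erase w = ∅ ∨ s.erase w ∈ K.faces)}
  isRelLowerSet_faces := by
    rintro s (hs | ⟨hw, hs⟩)
    · exact ⟨(K.isRelLowerSet_faces hs).1,
        fun t ht hne => Or.inl ((K.isRelLowerSet_faces hs).2 ht hne)⟩
    · refine ⟨⟨w, hw⟩, fun t ht hne => ?_⟩
      have hsub : t.erase w ⊆ s.erase w := Finset.erase_subset_erase w ht
      have key : t.erase w = ∅ ∨ t.erase w ∈ K.faces := by
        rcases Finset.eq_empty_or_nonempty (t.erase w) with h | h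
        · exact Or.inl h
        · rcases hs with hs | hs
          · rw [hs] at hsub
            exact Or.inl (Finset.subset_empty.mp hsub)
          · exact Or.inr ((K.isRelLowerSet_faces hs).2 hsub h)
      by_cases hwt : w ∈ t
      · exact Or.inr ⟨hwt, key⟩
      · rw [Finset.erase_eq_of_notMem hwt] at key
        exact Or.inl (key.resolve_left hne.ne_empty)

/-- The stellar subdivision of `K` along the simplex `σ`, with new vertex `w`: the simplices that
contain `σ` are removed, and the simplices `τ ∪ {w}` with `σ ⊄ τ` and `τ ∪ σ ∈ K` are added. -/
def stellar {V : Type*} [DecidableEq V] (K : PreAbstractSimplicialComplex V) (σ : Finset V) (w : V) :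
    PreAbstractSimplicialComplex V where
  faces := {s | s ∈ K.faces ∧ ¬ σ ⊆ s} ∪
    {s | w ∈ s ∧ ¬ σ ⊆ s.erase w ∧ s.erase w ∪ σ ∈ K.faces}
  isRelLowerSet_faces := by
    rintro s (⟨hs, hσ⟩ | ⟨hw, hσ, hs⟩)
    · exact ⟨(K.isRelLowerSet_faces hs).1, fun t ht hne =>
        Or.inl ⟨(K.isRelLowerSet_faces hs).2 ht hne, fun h => hσ (h.trans ht)⟩⟩
    · refine ⟨⟨w, hw⟩, fun t ht hne => ?_⟩
      have hsub : t.erase w ⊆ s.erase w := Finset.erase_subset_erase w ht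
      have hσt : ¬ σ ⊆ t.erase w := fun h => hσ (h.trans hsub)
      by_cases hwt : w ∈ t
      · refine Or.inr ⟨hwt, hσt, (K.isRelLowerSet_faces hs).2
          (Finset.union_subset_union_left hsub) ?_⟩
        by_contra hem
        rw [Finset.not_nonempty_iff_eq_empty, Finset.union_eq_empty] at hem
        exact hσt (by rw [hem.2]; exact Finset.empty_subset _)
      · rw [Finset.erase_eq_of_notMem hwt] at hsub hσt
        exact Or.inl ⟨(K.isRelLowerSet_faces hs).2
          (hsub.trans Finset.subset_union_left) hne, hσt⟩

/-! ### Truncations of codimension 2 faces -/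

/-- `K` is the boundary complex of the polytope dual to `A`: its simplices correspond to the
nonempty faces of `A` with inclusions reversed (the empty simplex corresponds to `A` itself). Such a
simplicial complex exists exactly when the polytope `A` is simple. -/
abbrev DualIso (A : Set E) (K : PreAbstractSimplicialComplex ℕ) : Type _ :=
  Face A ≃o (Simplex K)ᵒᵈ

/-- The polytope `P'` is obtained from the polytope `P` by truncation of a face `G` of codimension
2: the complex `∂P'*` is the stellar subdivision of `∂P*` along the simplex of `G`. The complexes are
finite, so it is no restriction to label their vertices by natural numbers. -/
structure Truncation {n : ℕ} (P P' : ConvexPolytope E n) where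
  /-- the truncated face -/
  G : Face P.carrier
  codim_G : dim G.1 + 2 = n
  /-- the complex `∂P*` -/
  K : PreAbstractSimplicialComplex ℕ
  /-- the correspondence between the faces of `P` and the simplices of `K` -/
  e : DualIso P.carrier K
  /-- the new vertex -/
  w : ℕ
  w_new : {w} ∉ K.faces
  /-- the correspondence between the faces of `P'` and the simplices of the subdivision -/
  e' : DualIso P'.carrier (stellar K (OrderDual.ofDual (e G)).1 w)

namespace Truncation

variable {n : ℕ} {P P' : ConvexPolytope E n} (T : Truncation P P')

/-- The simplex of the truncated face. -/
def σ : Finset ℕ := (OrderDual.ofDual (T.e T.G)).1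

/-- The simplex of a face of the new polytope. -/
def simplex' (Q' : Face P'.carrier) : Finset ℕ := (OrderDual.ofDual (T.e' Q')).1

theorem simplex'_of_mem (Q' : Face P'.carrier) (h : T.w ∈ T.simplex' Q') :
    (T.simplex' Q').erase T.w ∪ T.σ = ∅ ∨ (T.simplex' Q').erase T.w ∪ T.σ ∈ T.K.faces := by
  rcases (OrderDual.ofDual (T.e' Q')).2 with h0 | (h1 | h2)
  · have h0' : T.simplex' Q' = ∅ := h0
    simp [h0'] at h
  · exact absurd ((T.K.isRelLowerSet_faces h1.1).2
      (Finset.singleton_subset_iff.mpr h) (Finset.singleton_nonempty _)) T.w_new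
  · exact Or.inr h2.2.2

theorem simplex'_of_notMem (Q' : Face P'.carrier) (h : T.w ∉ T.simplex' Q') :
    T.simplex' Q' = ∅ ∨ T.simplex' Q' ∈ T.K.faces := by
  rcases (OrderDual.ofDual (T.e' Q')).2 with h0 | (h1 | h2)
  · exact Or.inl h0
  · exact Or.inr h1.1
  · exact absurd h2.1 h

/-- The face `Q` of `P` from which the face `Q'` of `P'` arises. If `Q'` does not lie in the section
facet, its simplex is a simplex of `∂P*`, and `Q` is the face of that simplex: `Q'` is `Q`, unchanged
or truncated. If `Q'` lies in the section facet, which is `G × I`, its simplex is `τ ∪ {w}`, and `Q` is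
the face `τ ∪ σ`, contained in `G`: here `Q'` is `Q × I` (if `τ` and `σ` are disjoint) or a copy of `Q`
in one of the two ends of `G × I`. -/
def oldFace (Q' : Face P'.carrier) : Face P.carrier :=
  if h : T.w ∈ T.simplex' Q' then
    T.e.symm (OrderDual.toDual ⟨(T.simplex' Q').erase T.w ∪ T.σ, T.simplex'_of_mem Q' h⟩)
  else
    T.e.symm (OrderDual.toDual ⟨T.simplex' Q', T.simplex'_of_notMem Q' h⟩)

open scoped Classical in
/-- One step of the construction of the complexes `Δ(Q)`: if `G ∩ Q` is a face of codimension 2 of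
`Q`, so that `Q'` is the 2-truncation of `Q` along `G ∩ Q`, then
`Δ(Q') = Δ(Q) ∪ (Δ(G ∩ Q) ⋆ v)`, where `v` is the new vertex; otherwise `Δ(Q') = Δ(Q)`.
(A face `Q'` in the section facet has `Q ⊆ G`, so `G ∩ Q = Q` and the second case applies.) -/
def step (Δ : Face P.carrier → PreAbstractSimplicialComplex ℕ) (v : ℕ)
    (Q' : Face P'.carrier) : PreAbstractSimplicialComplex ℕ :=
  if h : (T.G.1 ∩ (T.oldFace Q').1).Nonempty then
    if dim (T.G.1 ∩ (T.oldFace Q').1) + 2 = dim (T.oldFace Q').1 then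
      Δ (T.oldFace Q') ⊔ cone (Δ (T.G.inter (T.oldFace Q') h)) v
    else Δ (T.oldFace Q')
  else Δ (T.oldFace Q')

end Truncation

/-! ### 2-truncated cubes and the complexes `Δ(Q)` -/

/-- The cube `[0, 1] ^ n`. -/
def unitCube (n : ℕ) : Set (EuclideanSpace ℝ (Fin n)) := {x | ∀ i, x i ∈ Set.Icc (0 : ℝ) 1}

/-- A sequence of `m` truncations of codimension 2 faces that leads from an `n`-dimensional
(combinatorial) cube to the polytope `P`. -/
inductive TruncationSequence {n : ℕ} : ConvexPolytope E n → ℕ → Type _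
  | cube (P : ConvexPolytope E n) (e : Face P.carrier ≃o Face (unitCube n)) :
      TruncationSequence P 0
  | truncate {P : ConvexPolytope E n} {m : ℕ} (S : TruncationSequence P m)
      (P' : ConvexPolytope E n) (T : Truncation P P') : TruncationSequence P' (m + 1)

/-- The complexes `Δ(Q)`, `Q` a face of `P`, built along the sequence of truncations; the vertex of
the section facet of the `(k + 1)`-st truncation is `k`. For a cube all of them have no vertices. -/
def TruncationSequence.Δ {n : ℕ} : {P : ConvexPolytope E n} → {m : ℕ} →
    TruncationSequence P m → Face P.carrier → PreAbstractSimplicialComplex ℕ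
  | _, _, .cube _ _ => fun _ => ⊥
  | _, _, .truncate (m := m) S _ T => T.step S.Δ m

/-- `P` is a 2-truncated cube. -/
def IsTwoTruncatedCube {n : ℕ} (P : ConvexPolytope E n) : Prop :=
  ∃ m : ℕ, Nonempty (TruncationSequence P m)

end TwoTruncatedCube

end

/-!
A truncation of `P` in a face `G` of codimension 2 changes the polynomials `H` in a controlled way:
a face `Q` for which `G ∩ Q` has codimension 2 in `Q` gains the summand `α t H(G ∩ Q)`, every other
face of `P` that survives keeps its `H`, and the faces of the section facet `G × I` are copies of
faces of `G` or prisms over them, whose `H` is that of the base multiplied by `α + t`. On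
`γ`-polynomials this reads `γ(Q') = γ(Q) + τ γ(G ∩ Q)`, respectively `γ(Q') = γ(Q)`, which is the
rule that the `f`-polynomials of `Δ(Q) ∪ (Δ(G ∩ Q) ⋆ w)` and `Δ(Q)` obey.

For the flag property one keeps track of all faces at once: the complexes `Δ(Q)` are the clique
complexes of one graph `G`, on vertex sets `W(Q)` with `W(Q ∩ R) = W(Q) ∩ W(R)`. The new vertex is
joined to `W(G)` and belongs to `W(Q')` exactly if the truncation cuts `Q`. That this is compatible
with intersections is the Helly property of the face poset (three faces that meet pairwise have a
common point), which amounts to `∂P*` being flag and is inherited by subdivisions of edges.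
-/

noncomputable section

namespace TwoTruncatedCube

variable {E : Type*} [NormedAddCommGroup E] [NormedSpace ℝ E]

/-! ### Faces of polytopes -/

section Exposed

variable {A B C S : Set E} {b c : E}

theorem isExposed_iff_exists_dual (hb : b ∈ B) :
    IsExposed ℝ A B ↔ B ⊆ A ∧
      ∃ l : StrongDual ℝ E, (∀ x ∈ B, l x = l b) ∧ ∀ x ∈ A, x ∉ B → l x < l b := by
  constructor
  · intro hB
    obtain ⟨l, rfl⟩ := hB ⟨b, hb⟩
    refine ⟨hB.subset, l, fun x hx => le_antisymm (hb.2 x hx.1) (hx.2 b hb.1), fun x hxA hx => ?_⟩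
    by_contra! hle
    exact hx ⟨hxA, fun y hy => (hb.2 y hy).trans hle⟩
  · rintro ⟨hBA, l, heq, hlt⟩ -
    refine ⟨l, Set.Subset.antisymm (fun x hx => ⟨hBA hx, fun y hy => ?_⟩) fun x hx => ?_⟩
    · by_cases hyB : y ∈ B
      · rw [heq x hx, heq y hyB]
      · exact (heq x hx).symm ▸ (hlt y hy hyB).le
    · by_contra hxB
      exact (hlt x hx.1 hxB).not_ge (hx.2 b (hBA hb))

theorem isExposed_setOf_eq {l : StrongDual ℝ E} (hb : b ∈ A) (hmax : ∀ x ∈ A, l x ≤ l b) :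
    IsExposed ℝ A {x ∈ A | l x = l b} :=
  (isExposed_iff_exists_dual (show b ∈ {x ∈ A | l x = l b} from ⟨hb, rfl⟩)).mpr
    ⟨fun _ hx => hx.1, l, fun _ hx => hx.2,
      fun x hx hxB => (hmax x hx).lt_of_ne fun h => hxB ⟨hx, h⟩⟩

theorem lt_of_mem_convexHull_of_notMem (hB : Convex ℝ B) (l : StrongDual ℝ E) {r : ℝ}
    (heq : ∀ x ∈ B, l x = r) (hlt : ∀ v ∈ S, v ∉ B → l v < r) {x : E}
    (hx : x ∈ convexHull ℝ S) (hxB : x ∉ B) : l x < r := by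
  have hconv : Convex ℝ (B ∪ {x | l x < r}) := by
    have hle : ∀ x ∈ B ∪ {x | l x < r}, l x ≤ r := fun x hx =>
      hx.elim (fun h => (heq x h).le) fun h => h.le
    rw [convex_iff_forall_pos]
    intro y hy z hz p q hp hq hpq
    by_cases hyz : y ∈ B ∧ z ∈ B
    · exact Or.inl (hB hyz.1 hyz.2 hp.le hq.le hpq)
    right
    have hr : p * r + q * r = r := by rw [← add_mul, hpq, one_mul]
    rw [Set.mem_ofPred_eq, map_add, map_smul, map_smul, smul_eq_mul, smul_eq_mul, ← hr]
    by_cases hyB : y ∈ B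
    · exact add_lt_add_of_le_of_lt (mul_le_mul_of_nonneg_left (hle y hy) hp.le)
        (mul_lt_mul_of_pos_left (hz.resolve_left fun h => hyz ⟨hyB, h⟩) hq)
    · exact add_lt_add_of_lt_of_le (mul_lt_mul_of_pos_left (hy.resolve_left hyB) hp)
        (mul_le_mul_of_nonneg_left (hle z hz) hq.le)
  have hS : S ⊆ B ∪ {x | l x < r} := fun v hv => (em (v ∈ B)).imp_right (hlt v hv)
  exact (convexHull_min hS hconv hx).resolve_left hxB

theorem eq_convexHull_inter_of_isExposed (hS : S.Finite) (hB : IsExposed ℝ (convexHull ℝ S) B) :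
    B = convexHull ℝ (S ∩ B) := by
  have hconv : Convex ℝ B := hB.convex (convex_convexHull ℝ _)
  have hcompact : IsCompact B := hB.isCompact (hS.isCompact_convexHull ℝ)
  have hext : B.extremePoints ℝ ⊆ S ∩ B := fun x hx =>
    ⟨extremePoints_convexHull_subset (hB.isExtreme.extremePoints_subset_extremePoints hx), hx.1⟩
  refine subset_antisymm ?_ (convexHull_min Set.inter_subset_right hconv)
  calc B = closure (convexHull ℝ (B.extremePoints ℝ)) :=
        (closure_convexHull_extremePoints hcompact hconv).symm
    _ ⊆ convexHull ℝ (S ∩ B) := closure_minimal (convexHull_mono hext)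
        ((hS.subset Set.inter_subset_left).isClosed_convexHull ℝ)

theorem vectorSpan_le_ker {f : E →ₗ[ℝ] ℝ} {r : ℝ} (h : ∀ x ∈ A, f x = r) :
    vectorSpan ℝ A ≤ LinearMap.ker f := by
  rw [vectorSpan, Submodule.span_le]
  rintro _ ⟨x, hx, y, hy, rfl⟩
  simp [h x hx, h y hy]

theorem vectorSpan_lt_of_isExposed (hB : IsExposed ℝ A B) (hne : B.Nonempty) (hBA : B ≠ A) :
    vectorSpan ℝ B < vectorSpan ℝ A := by
  obtain ⟨b, hb⟩ := hne
  obtain ⟨hsub, l, heq, hlt⟩ := (isExposed_iff_exists_dual hb).mp hB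
  obtain ⟨x, hxA, hxB⟩ := Set.exists_of_ssubset (hsub.ssubset_of_ne hBA)
  refine (vectorSpan_mono ℝ hsub).lt_of_not_ge fun hle => (hlt x hxA hxB).ne ?_
  have hker : x - b ∈ LinearMap.ker l.toLinearMap :=
    vectorSpan_le_ker heq (hle (vsub_mem_vectorSpan ℝ hxA (hsub hb)))
  exact sub_eq_zero.mp ((map_sub l x b).symm.trans hker)

end Exposed

/-- A convex polytope, possibly empty: the convex hull of a finite set. -/
def IsPolytope (A : Set E) : Prop := ∃ S : Set E, S.Finite ∧ A = convexHull ℝ S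

theorem ConvexPolytope.isPolytope {n : ℕ} (P : ConvexPolytope E n) : IsPolytope P.carrier :=
  let ⟨S, _, h⟩ := P.isHull
  ⟨S, S.finite_toSet, h⟩

theorem ConvexPolytope.nonempty {n : ℕ} (P : ConvexPolytope E n) : P.carrier.Nonempty := by
  obtain ⟨S, hS, h⟩ := P.isHull
  rw [h]
  exact (Finset.coe_nonempty.mpr hS).convexHull

theorem exists_mem_ker_notMem {F V : Type*} [Field F] [AddCommGroup V] [Module F V]
    {U W : Submodule F V} [FiniteDimensional F U] [FiniteDimensional F W] (l : V →ₗ[F] F)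
    (h : Module.finrank F W + 2 ≤ Module.finrank F U) : ∃ x ∈ U, l x = 0 ∧ x ∉ W := by
  by_contra! hcon
  have hle : (LinearMap.ker (l.domRestrict U)).map U.subtype ≤ W := by
    rintro _ ⟨x, hx, rfl⟩
    exact hcon x x.2 hx
  have hker := (Submodule.finrank_map_subtype_eq U _).symm.trans_le (Submodule.finrank_mono hle)
  have hrange := (LinearMap.range (l.domRestrict U)).finrank_le
  have hrank := (l.domRestrict U).finrank_range_add_finrank_ker
  rw [Module.finrank_self] at hrange
  omega

theorem exists_dual_ne_zero_of_notMem {W : Submodule ℝ E} [FiniteDimensional ℝ W] {x : E}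
    (hx : x ∉ W) : ∃ g : StrongDual ℝ E, g x ≠ 0 ∧ ∀ y ∈ W, g y = 0 := by
  have : IsClosed (W : Set E) := W.closed_of_finiteDimensional
  have hmkQ : ∀ y, W.mkQL y = 0 ↔ y ∈ W := fun y => Submodule.Quotient.mk_eq_zero W
  obtain ⟨g, hg⟩ := SeparatingDual.exists_ne_zero (R := ℝ) (mt (hmkQ x).mp hx)
  exact ⟨g.comp W.mkQL, hg, fun y hy => (congrArg g ((hmkQ y).mpr hy)).trans (map_zero g)⟩

theorem exists_apply_ne_of_mem_vectorSpan {S : Set E} {x : E}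
    (hx : x ∈ vectorSpan ℝ (convexHull ℝ S)) {f : StrongDual ℝ E} (hfx : f x ≠ 0) (r : ℝ) :
    ∃ v ∈ S, f v ≠ r := by
  by_contra! hcon
  exact hfx (vectorSpan_le_ker (f := f.toLinearMap)
    (convexHull_min hcon (convex_hyperplane f.toLinearMap.isLinear r)) hx)

theorem exists_dual_const_lt {S B : Set E} {x b : E} (hb : b ∈ B)
    (hx : x ∈ vectorSpan ℝ (convexHull ℝ S)) [FiniteDimensional ℝ (vectorSpan ℝ B)]
    (hxB : x ∉ vectorSpan ℝ B) :
    ∃ g : StrongDual ℝ E, g x ≠ 0 ∧ (∀ y ∈ B, g y = g b) ∧ ∃ v ∈ S, g b < g v := by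
  obtain ⟨g, hgx, hg⟩ := exists_dual_ne_zero_of_notMem hxB
  have hgB : ∀ y ∈ B, g y = g b := fun y hy =>
    sub_eq_zero.mp ((map_sub g y b).symm.trans (hg _ (vsub_mem_vectorSpan ℝ hy hb)))
  obtain ⟨v, hv, hvb⟩ := exists_apply_ne_of_mem_vectorSpan hx hgx (g b)
  rcases hvb.lt_or_gt with h | h
  · exact ⟨-g, neg_ne_zero.mpr hgx, fun y hy => congrArg Neg.neg (hgB y hy), v, hv, neg_lt_neg h⟩
  · exact ⟨g, hgx, hgB, v, hv, h⟩

theorem exists_maximal_mul_le {ι : Type*} {s : Set ι} (hs : s.Finite) {a b : ι → ℝ}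
    (ha : ∀ i ∈ s, 0 ≤ a i) (hab : ∀ i ∈ s, 0 < b i → 0 < a i) (hb : ∃ i ∈ s, 0 < b i) :
    ∃ t > 0, (∀ i ∈ s, t * b i ≤ a i) ∧ ∃ i ∈ s, 0 < b i ∧ t * b i = a i := by
  obtain ⟨j, hj, hmin⟩ := Set.exists_min_image {i ∈ s | 0 < b i} (fun i => a i / b i)
    (hs.subset fun i hi => hi.1) hb
  have ht : 0 < a j / b j := div_pos (hab j hj.1 hj.2) hj.2
  refine ⟨a j / b j, ht, fun i hi => ?_, j, hj.1, hj.2, div_mul_cancel₀ _ hj.2.ne'⟩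
  by_cases hbi : 0 < b i
  · exact (le_div_iff₀ hbi).mp (hmin i ⟨hi, hbi⟩)
  · exact (mul_nonpos_of_nonneg_of_nonpos ht.le (not_lt.mp hbi)).trans (ha i hi)

theorem exists_dual_tilt {S B : Set E} {b : E} (hS : S.Finite) {l g : StrongDual ℝ E}
    (heq : ∀ x ∈ B, l x = l b) (hlt : ∀ v ∈ S, v ∉ B → l v < l b) (hgB : ∀ x ∈ B, g x = g b)
    (hgS : ∃ v ∈ S, g b < g v) :
    ∃ t > 0, (∀ v ∈ S, l v + t * g v ≤ l b + t * g b) ∧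
      ∃ v ∈ S, v ∉ B ∧ l v + t * g v = l b + t * g b := by
  have hnotMem : ∀ v, g b < g v → v ∉ B := fun v hv hvB => hv.ne' (hgB v hvB)
  have hle : ∀ v ∈ S, l v ≤ l b := fun v hv =>
    (em (v ∈ B)).elim (fun h => (heq v h).le) fun h => (hlt v hv h).le
  obtain ⟨t, ht, hmax, v, hv, hgv, hfv⟩ := exists_maximal_mul_le hS
    (a := fun v => l b - l v) (b := fun v => g v - g b) (fun v hv => sub_nonneg.mpr (hle v hv))
    (fun v hv hgv => sub_pos.mpr (hlt v hv (hnotMem v (sub_pos.mp hgv))))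
    (hgS.imp fun v hv => ⟨hv.1, sub_pos.mpr hv.2⟩)
  exact ⟨t, ht, fun v hv => by linarith [hmax v hv], v, hv, hnotMem v (sub_pos.mp hgv),
    by linarith⟩

namespace IsPolytope

variable {A B C : Set E}

theorem of_isExposed (hA : IsPolytope A) (hB : IsExposed ℝ A B) : IsPolytope B := by
  obtain ⟨S, hS, rfl⟩ := hA
  exact ⟨S ∩ B, hS.subset Set.inter_subset_left, eq_convexHull_inter_of_isExposed hS hB⟩

theorem finite_face (hA : IsPolytope A) : Finite (Face A) := by
  obtain ⟨S, hS, rfl⟩ := hA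
  have : Finite (Set.powerset S) := hS.finite_subsets
  refine Finite.of_injective
    (fun B => (⟨S ∩ B.1, Set.inter_subset_left⟩ : Set.powerset S)) fun B C h => Subtype.ext ?_
  have hSBC : S ∩ B.1 = S ∩ C.1 := congrArg Subtype.val h
  rw [eq_convexHull_inter_of_isExposed hS B.2.2, eq_convexHull_inter_of_isExposed hS C.2.2, hSBC]

theorem finiteDimensional_vectorSpan (hA : IsPolytope A) :
    FiniteDimensional ℝ (vectorSpan ℝ A) := by
  obtain ⟨S, hS, rfl⟩ := hA
  rw [← direction_affineSpan, affineSpan_convexHull, direction_affineSpan]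
  exact finiteDimensional_vectorSpan_of_finite ℝ hS

theorem isExposed_trans (hA : IsPolytope A) (hB : IsExposed ℝ A B) (hC : IsExposed ℝ B C) :
    IsExposed ℝ A C := by
  obtain ⟨S, hS, rfl⟩ := hA
  rcases C.eq_empty_or_nonempty with rfl | ⟨c, hc⟩
  · exact isExposed_empty
  obtain ⟨hBA, l, hl, hlt⟩ := (isExposed_iff_exists_dual (hC.subset hc)).mp hB
  obtain ⟨hCB, l', hl', hlt'⟩ := (isExposed_iff_exists_dual hc).mp hC
  have hlarge : ∀ᶠ N : ℝ in Filter.atTop, ∀ v ∈ S, v ∉ B → l' v - l' c < N * (l c - l v) := by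
    refine (Filter.eventually_all_finite hS).mpr fun v hv => ?_
    by_cases hvB : v ∈ B
    · exact Filter.Eventually.of_forall fun _ h => absurd hvB h
    filter_upwards [Filter.eventually_gt_atTop ((l' v - l' c) / (l c - l v))] with N hN _
    exact (div_lt_iff₀ (sub_pos.mpr (hlt v (subset_convexHull ℝ S hv) hvB))).mp hN
  obtain ⟨N, hN⟩ := hlarge.exists
  have happ : ∀ x, (N • l + l') x = N * l x + l' x := fun x => rfl
  have heq : ∀ x ∈ C, (N • l + l') x = (N • l + l') c := fun x hx => by
    rw [happ, happ, hl x (hCB hx), hl' x hx]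
  refine (isExposed_iff_exists_dual hc).mpr ⟨hCB.trans hBA, N • l + l', heq, fun x hx hxC =>
    lt_of_mem_convexHull_of_notMem (hC.convex (hB.convex (convex_convexHull ℝ S))) _ heq
      (fun v hv hvC => ?_) hx hxC⟩
  rw [happ, happ]
  by_cases hvB : v ∈ B
  · rw [hl v hvB]
    linarith [hlt' v hvB hvC]
  · linarith [hN v hv hvB]

/-- The functional `l` exposing `B` is tilted towards a functional `g` constant on `B`, just until
some further vertex becomes a maximum. -/
theorem exists_isExposed_between (hA : IsPolytope A) (hB : IsExposed ℝ A B) (hne : B.Nonempty)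
    (hdim : dim B + 2 ≤ dim A) : ∃ D, IsExposed ℝ A D ∧ B ⊂ D ∧ D ⊂ A := by
  have := hA.finiteDimensional_vectorSpan
  have := (hA.of_isExposed hB).finiteDimensional_vectorSpan
  obtain ⟨S, hS, rfl⟩ := hA
  obtain ⟨b, hb⟩ := hne
  obtain ⟨hBA, l, heq, hlt⟩ := (isExposed_iff_exists_dual hb).mp hB
  obtain ⟨x, hxA, hlx, hxB⟩ := exists_mem_ker_notMem l.toLinearMap hdim
  obtain ⟨g, hgx, hgB, hgS⟩ := exists_dual_const_lt hb hxA hxB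
  obtain ⟨t, ht, hle, v, hv, hvB, hfv⟩ := exists_dual_tilt hS heq
    (fun v hv => hlt v (subset_convexHull ℝ S hv)) hgB hgS
  set f : StrongDual ℝ E := l + t • g
  have happ : ∀ y, f y = l y + t * g y := fun y => rfl
  simp only [← happ] at hle hfv
  have hfx : f x ≠ 0 := by
    rw [happ, show l x = 0 from hlx, zero_add]
    exact mul_ne_zero ht.ne' hgx
  obtain ⟨u, hu, hfu⟩ := exists_apply_ne_of_mem_vectorSpan hxA hfx (f b)
  refine ⟨{y ∈ convexHull ℝ S | f y = f b}, isExposed_setOf_eq (hBA hb)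
    (convexHull_min hle (convex_halfSpace_le f.toLinearMap.isLinear (f b))),
    Set.ssubset_iff_exists.mpr ⟨fun y hy => ⟨hBA hy, ?_⟩, v, ⟨subset_convexHull ℝ S hv, hfv⟩, hvB⟩,
    Set.ssubset_iff_exists.mpr
      ⟨fun y hy => hy.1, u, subset_convexHull ℝ S hu, fun h => hfu h.2⟩⟩
  rw [happ, happ, heq y hy, hgB y hy]

end IsPolytope

section Grading

variable {A : Set E}

theorem Face.isExposed_of_le {B C : Face A} (h : B ≤ C) : IsExposed ℝ C.1 B.1 :=
  B.2.2.mono C.2.2.subset h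

theorem IsPolytope.dim_strictMono (hA : IsPolytope A) :
    StrictMono fun B : Face A => dim B.1 := fun B C h => by
  have := (hA.of_isExposed C.2.2).finiteDimensional_vectorSpan
  exact Submodule.finrank_lt_finrank_of_lt
    (vectorSpan_lt_of_isExposed (Face.isExposed_of_le h.le) B.2.1 fun heq => h.ne (Subtype.ext heq))

theorem IsPolytope.dim_covBy (hA : IsPolytope A) {B C : Face A} (h : B ⋖ C) :
    dim B.1 + 1 = dim C.1 := by
  have hlt : dim B.1 < dim C.1 := hA.dim_strictMono h.lt
  by_contra hne
  obtain ⟨D, hD, hBD, hDC⟩ := (hA.of_isExposed C.2.2).exists_isExposed_between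
    (Face.isExposed_of_le h.le) B.2.1 (by omega)
  exact h.2 (c := ⟨D, B.2.1.mono hBD.subset, hA.isExposed_trans C.2.2 hD⟩) hBD hDC

theorem IsPolytope.dim_add_eq_dim (hA : IsPolytope A) {r : Face A → ℕ} (hr : StrictAnti r)
    (hzero : ∀ B, r B = 0 → IsTop B) (hsucc : ∀ B, r B ≠ 0 → ∃ C > B, r B = r C + 1)
    (B : Face A) : dim B.1 + r B = dim A := by
  induction h : r B generalizing B with
  | zero =>
    have hA' : (⟨A, B.2.1.mono B.2.2.subset, IsExposed.refl A⟩ : Face A) ≤ B := hzero B h _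
    rw [add_zero, B.2.2.subset.antisymm hA']
  | succ k ih =>
    obtain ⟨C, hBC, hC⟩ := hsucc B (by omega)
    have hcov : B ⋖ C := ⟨hBC, fun D hBD hDC => by have := hr hBD; have := hr hDC; omega⟩
    have := hA.dim_covBy hcov
    have := ih C (by omega)
    omega

end Grading

/-- The faces of a face `Q` are the faces of the polytope contained in `Q`. -/
def IsPolytope.faceEquiv {A : Set E} (hA : IsPolytope A) (Q : Face A) :
    Face Q.1 ≃ {B : Face A // B ≤ Q} where
  toFun B := ⟨⟨B.1, B.2.1, hA.isExposed_trans Q.2.2 B.2.2⟩, B.2.2.subset⟩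
  invFun B := ⟨B.1.1, B.1.2.1, Face.isExposed_of_le B.2⟩
  left_inv _ := rfl
  right_inv _ := rfl

theorem IsPolytope.faceNumber_eq {A : Set E} (hA : IsPolytope A) [Fintype (Face A)]
    [DecidableLE (Face A)] (Q : Face A) (i : ℕ) :
    faceNumber Q.1 i = Finset.card {B : Face A | B ≤ Q ∧ dim B.1 = i} := by
  rw [← Fintype.card_subtype, ← Nat.card_eq_fintype_card]
  exact Nat.card_congr (((hA.faceEquiv Q).subtypeEquiv fun _ => Iff.rfl).trans
    (Equiv.subtypeSubtypeEquivSubtypeInter (· ≤ Q) fun B => dim B.1 = i))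

theorem IsPolytope.HPolynomial_eq {A : Set E} (hA : IsPolytope A) [Fintype (Face A)]
    [DecidableLE (Face A)] (Q : Face A) :
    HPolynomial Q.1 = ∑ B : Face A with B ≤ Q,
      (MvPolynomial.X 0 - MvPolynomial.X 1) ^ dim B.1 *
        MvPolynomial.X 1 ^ (dim Q.1 - dim B.1) := by
  have hrange : ∀ B ∈ ({B | B ≤ Q} : Finset (Face A)), dim B.1 ∈ Finset.range (dim Q.1 + 1) :=
    fun B hB => Finset.mem_range_succ_iff.mpr
      (hA.dim_strictMono.monotone (Finset.mem_filter.mp hB).2)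
  rw [HPolynomial, FPolynomial, map_sum, ← Finset.sum_fiberwise_of_maps_to hrange]
  refine Finset.sum_congr rfl fun i _ => ?_
  rw [Finset.filter_filter, hA.faceNumber_eq, Finset.sum_congr rfl
    (g := fun _ => (MvPolynomial.X 0 - MvPolynomial.X 1) ^ i * MvPolynomial.X 1 ^ (dim Q.1 - i))
    fun B hB => by rw [(Finset.mem_filter.mp hB).2.2], Finset.sum_const]
  simp [mul_assoc]

/-! ### Flag complexes and stellar subdivisions -/

/-- `s` is a simplex of `K`, possibly the empty one. -/
def IsSimplex {V : Type*} (K : PreAbstractSimplicialComplex V) (s : Finset V) : Prop :=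
  s = ∅ ∨ s ∈ K.faces

/-- Three elements with pairwise common lower bounds have a common lower bound. For the nonempty
faces of a polytope, this says that faces which meet pairwise have a common point. -/
def IsHelly (α : Type*) [Preorder α] : Prop :=
  ∀ a b c : α, BddBelow {a, b} → BddBelow {b, c} → BddBelow {a, c} → BddBelow {a, b, c}

theorem IsHelly.of_orderIso {α β : Type*} [Preorder α] [Preorder β] (e : α ≃o β)
    (h : IsHelly α) : IsHelly β := by
  intro a b c hab hbc hac
  have hpre : ∀ s : Set β, BddBelow s ↔ BddBelow (e.symm '' s) := fun s =>
    (e.symm.bddBelow_image (s := s)).symm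
  simp only [hpre, Set.image_insert_eq, Set.image_singleton] at hab hbc hac ⊢
  exact h _ _ _ hab hbc hac

section Complex

variable {V : Type*} {K : PreAbstractSimplicialComplex V} {s t : Finset V} {w : V}

theorem IsSimplex.mono (ht : IsSimplex K t) (h : s ⊆ t) : IsSimplex K s := by
  rcases s.eq_empty_or_nonempty with rfl | hne
  · exact Or.inl rfl
  · exact Or.inr ((K.isRelLowerSet_faces (ht.resolve_left (hne.mono h).ne_empty)).2 h hne)

theorem isSimplex_iff_mem_faces (hs : s.Nonempty) : IsSimplex K s ↔ s ∈ K.faces :=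
  or_iff_right hs.ne_empty

theorem IsSimplex.notMem (hs : IsSimplex K s) (hw : {w} ∉ K.faces) : w ∉ s := fun h =>
  hw ((isSimplex_iff_mem_faces (Finset.singleton_nonempty w)).mp
    (hs.mono (Finset.singleton_subset_iff.mpr h)))

variable [DecidableEq V]

theorem IsSimplex.pair (hs : IsSimplex K s) {u v : V} (hu : u ∈ s) (hv : v ∈ s) :
    IsSimplex K {u, v} :=
  hs.mono (Finset.insert_subset hu (Finset.singleton_subset_iff.mpr hv))

theorem isFlag_iff : IsFlag K ↔
    ∀ s : Finset V, (∀ u ∈ s, ∀ v ∈ s, IsSimplex K {u, v}) → IsSimplex K s := by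
  constructor
  · refine fun hK s hs => s.eq_empty_or_nonempty.imp_right fun hne => hK s hne
      (fun v hv => ?_) fun u hu v hv _ => ?_
    · rw [← isSimplex_iff_mem_faces (Finset.singleton_nonempty v), ← Finset.pair_eq_singleton]
      exact hs v hv v hv
    · exact (isSimplex_iff_mem_faces (Finset.insert_nonempty _ _)).mp (hs u hu v hv)
  · refine fun hK s hne hvert hedge => (isSimplex_iff_mem_faces hne).mp
      (hK s fun u hu v hv => Or.inr ?_)
    rcases eq_or_ne u v with rfl | huv
    · rw [Finset.pair_eq_singleton]
      exact hvert u hu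
    · exact hedge u hu v hv huv

theorem isFlag_iff_isSimplex_union : IsFlag K ↔ ∀ p q r : Finset V, IsSimplex K (p ∪ q) →
    IsSimplex K (q ∪ r) → IsSimplex K (p ∪ r) → IsSimplex K (p ∪ q ∪ r) := by
  rw [isFlag_iff]
  constructor
  · intro hK p q r hpq hqr hpr
    refine hK _ fun u hu v hv => ?_
    have hpq' := hpq.pair (u := u) (v := v)
    have hqr' := hqr.pair (u := u) (v := v)
    have hpr' := hpr.pair (u := u) (v := v)
    grind
  · intro h
    have hinsert : ∀ x (t : Finset V), IsSimplex K t → (∀ v ∈ insert x t, IsSimplex K {x, v}) →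
        IsSimplex K (insert x t) := by
      intro x t ht hx
      induction t using Finset.induction_on with
      | empty => simpa using hx x
      | insert y t _ ih =>
        have hxt := ih (ht.mono (Finset.subset_insert y t))
          fun v hv => hx v (Finset.insert_subset_insert x (Finset.subset_insert y t) hv)
        have := h {x} {y} t (hx y (by simp)) ht hxt
        rwa [Finset.union_assoc] at this
    intro s hs
    induction s using Finset.induction_on with
    | empty => exact Or.inl rfl
    | insert x t _ ih =>
      exact hinsert x t (ih fun u hu v hv => hs u (Finset.mem_insert_of_mem hu) v
        (Finset.mem_insert_of_mem hv)) fun v hv => hs x (Finset.mem_insert_self x t) v hv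

variable {σ : Finset V}

theorem isSimplex_stellar_of_notMem (hσ : σ.Nonempty) (hws : w ∉ s) :
    IsSimplex (stellar K σ w) s ↔ IsSimplex K s ∧ ¬σ ⊆ s := by
  constructor
  · rintro (rfl | h | h)
    · exact ⟨Or.inl rfl, fun h => hσ.ne_empty (Finset.subset_empty.mp h)⟩
    · exact ⟨Or.inr h.1, h.2⟩
    · exact absurd h.1 hws
  · rintro ⟨rfl | hs, hσs⟩
    · exact Or.inl rfl
    · exact Or.inr (Or.inl ⟨hs, hσs⟩)

theorem isSimplex_stellar_insert (hσ : σ.Nonempty) (hw : {w} ∉ K.faces) (hws : w ∉ s) :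
    IsSimplex (stellar K σ w) (insert w s) ↔ ¬σ ⊆ s ∧ IsSimplex K (s ∪ σ) := by
  rw [isSimplex_iff_mem_faces (Finset.insert_nonempty w s),
    isSimplex_iff_mem_faces (hσ.mono Finset.subset_union_right)]
  have hfaces : insert w s ∉ K.faces := fun h =>
    IsSimplex.notMem (Or.inr h) hw (Finset.mem_insert_self w s)
  simp [stellar, hfaces, hws]

theorem IsFlag.isFlag_stellar (hK : IsFlag K) (hσ : σ ∈ K.faces) (hcard : σ.card = 2)
    (hw : {w} ∉ K.faces) : IsFlag (stellar K σ w) := by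
  rw [isFlag_iff] at hK ⊢
  have hσne : σ.Nonempty := (K.isRelLowerSet_faces hσ).1
  have hwσ : w ∉ σ := IsSimplex.notMem (Or.inr hσ) hw
  have hbase : ∀ s : Finset V, w ∉ s → (∀ u ∈ s, ∀ v ∈ s, IsSimplex (stellar K σ w) {u, v}) →
      IsSimplex K s ∧ ¬σ ⊆ s := by
    intro s hws hs
    have hpair : ∀ u ∈ s, ∀ v ∈ s, IsSimplex K {u, v} ∧ ¬σ ⊆ {u, v} := fun u hu v hv =>
      (isSimplex_stellar_of_notMem hσne (by
        rw [Finset.mem_insert, Finset.mem_singleton]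
        rintro (rfl | rfl) <;> contradiction)).mp (hs u hu v hv)
    refine ⟨hK s fun u hu v hv => (hpair u hu v hv).1, fun hσs => ?_⟩
    obtain ⟨a, b, -, rfl⟩ := Finset.card_eq_two.mp hcard
    exact (hpair a (hσs (by simp)) b (hσs (by simp))).2 subset_rfl
  intro s hs
  by_cases hws : w ∈ s
  · obtain ⟨τ, hwτ, rfl⟩ : ∃ τ, w ∉ τ ∧ insert w τ = s :=
      ⟨s.erase w, Finset.notMem_erase w s, Finset.insert_erase hws⟩
    obtain ⟨hτ, hστ⟩ := hbase τ hwτ fun u hu v hv =>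
      hs u (Finset.mem_insert_of_mem hu) v (Finset.mem_insert_of_mem hv)
    have hlink : ∀ u ∈ τ, IsSimplex K ({u} ∪ σ) := fun u hu => by
      have huw : w ∉ ({u} : Finset V) := fun h => hwτ (Finset.mem_singleton.mp h ▸ hu)
      exact ((isSimplex_stellar_insert hσne hw huw).mp
        (hs w (Finset.mem_insert_self w τ) u (Finset.mem_insert_of_mem hu))).2
    refine (isSimplex_stellar_insert hσne hw hwτ).mpr ⟨hστ, hK _ fun u hu v hv => ?_⟩
    rcases Finset.mem_union.mp hu with hu | hu <;> rcases Finset.mem_union.mp hv with hv | hv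
    · exact hτ.pair hu hv
    · exact (hlink u hu).pair (by simp) (by simp [hv])
    · exact (hlink v hv).pair (by simp [hu]) (by simp)
    · exact IsSimplex.pair (Or.inr hσ) hu hv
  · exact (isSimplex_stellar_of_notMem hσne hws).mpr (hbase s hws hs)

end Complex

/-! ### Counting the simplices that contain a given one -/

section StarSum

variable {V : Type*} [DecidableEq V] {R : Type*} [CommRing R]

/-- The sum of `x ^ (n - |u|) t ^ (|u| - |s|)` over the members `u` of `L` that contain `s`. If `L`
is the set of simplices of `∂P*`, with `dim P = n`, and `s` is the simplex of a face `Q` of `P`,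
this is the value of `F(Q)` at `(x, t)`. -/
def starSum (L : Finset (Finset V)) (n : ℕ) (x t : R) (s : Finset V) : R :=
  ∑ u ∈ L with s ⊆ u, x ^ (n - u.card) * t ^ (u.card - s.card)

theorem starSum_ssubsets_of_card_eq_one {ρ : Finset V} (hρ : ρ.card = 1) (n : ℕ) (x t : R) :
    starSum ρ.ssubsets n x t ∅ = x ^ n := by
  obtain ⟨a, rfl⟩ := Finset.card_eq_one.mp hρ
  have hsub : ({a} : Finset V).ssubsets = {∅} := by
    ext s
    simp [Finset.ssubset_singleton_iff]
  simp [starSum, hsub]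

theorem starSum_ssubsets_of_card_eq_two {ρ : Finset V} (hρ : ρ.card = 2) (x t : R) :
    starSum ρ.ssubsets 1 x t ∅ = x + 2 * t := by
  obtain ⟨a, b, hab, rfl⟩ := Finset.card_eq_two.mp hρ
  have hsub : ({a, b} : Finset V).ssubsets = {∅, {a}, {b}} := by
    ext s
    rw [Finset.mem_ssubsets, Finset.ssubset_iff_subset_ne, ← Finset.coe_subset, Finset.coe_pair,
      Set.subset_pair_iff_eq]
    norm_cast
    grind
  have hsum : starSum ({a, b} : Finset V).ssubsets 1 x t ∅ = x + (t + t) := by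
    rw [starSum, Finset.filter_true_of_mem fun s _ => Finset.empty_subset s, hsub,
      Finset.sum_insert (by simp), Finset.sum_pair (by simpa using hab)]
    simp
  rw [hsum, two_mul]

theorem starSum_eq_add_starSum_insert (L : Finset (Finset V)) (n : ℕ) (x t : R) {s : Finset V}
    {w : V} (hws : w ∉ s) : starSum L n x t s =
      ∑ u ∈ L with s ⊆ u ∧ w ∉ u, x ^ (n - u.card) * t ^ (u.card - s.card) +
        t * starSum L n x t (insert w s) := by
  rw [starSum, ← Finset.sum_filter_add_sum_filter_not _ (fun u => w ∉ u), Finset.filter_filter,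
    Finset.filter_filter, starSum, Finset.mul_sum]
  congr 1
  refine Finset.sum_congr (Finset.filter_congr fun u _ => ?_) fun u hu => ?_
  · rw [not_not, Finset.insert_subset_iff, and_comm]
  · have hcard := Finset.card_le_card (Finset.mem_filter.mp hu).2
    rw [Finset.card_insert_of_notMem hws] at hcard ⊢
    rw [show u.card - s.card = u.card - (s.card + 1) + 1 by omega]
    ring

theorem starSum_sub_starSum_union (L : Finset (Finset V)) (n : ℕ) (x t : R) (s σ : Finset V) :
    ∑ u ∈ L with s ⊆ u ∧ ¬σ ⊆ u, x ^ (n - u.card) * t ^ (u.card - s.card) =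
      starSum L n x t s - t ^ (σ \ s).card * starSum L n x t (s ∪ σ) := by
  rw [eq_sub_iff_add_eq, starSum, starSum, ← Finset.sum_filter_add_sum_filter_not (L.filter (s ⊆ ·))
    (fun u => ¬σ ⊆ u), Finset.filter_filter, Finset.filter_filter, Finset.mul_sum]
  congr 1
  refine Finset.sum_congr (Finset.filter_congr fun u _ => ?_) fun u hu => ?_
  · rw [not_not, Finset.union_subset_iff]
  · simp only [not_not, ← Finset.union_subset_iff] at hu
    have hcard := Finset.card_le_card (Finset.mem_filter.mp hu).2
    rw [← Finset.union_sdiff_self_eq_union, Finset.card_union_of_disjoint Finset.disjoint_sdiff]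
      at hcard ⊢
    rw [show u.card - s.card = u.card - (s.card + (σ \ s).card) + (σ \ s).card by omega]
    ring

theorem starSum_eq_zero {K : PreAbstractSimplicialComplex V} {L : Finset (Finset V)}
    (hL : ∀ s, s ∈ L ↔ IsSimplex K s) (n : ℕ) (x t : R) {s : Finset V} (hs : ¬IsSimplex K s) :
    starSum L n x t s = 0 := by
  rw [starSum, Finset.filter_false_of_mem fun u hu h => hs (((hL u).mp hu).mono h),
    Finset.sum_empty]

variable {K : PreAbstractSimplicialComplex V} {σ s : Finset V} {w : V} {L L' : Finset (Finset V)}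

theorem sum_union_mem_eq_sum_product (hL : IsLowerSet (L : Set (Finset V))) {M : Type*}
    [AddCommMonoid M] (s σ : Finset V) (f : Finset V → M) :
    ∑ τ ∈ L with s ⊆ τ ∧ ¬σ ⊆ τ ∧ τ ∪ σ ∈ L, f τ =
      ∑ p ∈ (σ \ s).ssubsets ×ˢ L.filter (s ∪ σ ⊆ ·), f (p.2 \ ((σ \ s) \ p.1)) := by
  refine Finset.sum_nbij' (fun τ => ((τ ∩ σ) \ s, τ ∪ σ)) (fun p => p.2 \ ((σ \ s) \ p.1))
    (fun τ hτ => ?_) (fun p hp => ?_) (fun τ hτ => ?_) (fun p hp => ?_) fun τ hτ => ?_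
  · obtain ⟨-, hsτ, hστ, hτL⟩ := Finset.mem_filter.mp hτ
    have hne : (τ ∩ σ) \ s ≠ σ \ s := fun h => hστ fun x hx => by
      have := Finset.ext_iff.mp h x
      clear * - hsτ hx this
      grind
    have hd : (τ ∩ σ) \ s ⊂ σ \ s :=
      (Finset.sdiff_subset_sdiff Finset.inter_subset_right subset_rfl).ssubset_of_ne hne
    simpa [hd, hτL] using Finset.union_subset_union_left hsτ
  · simp only [Finset.mem_product, Finset.mem_ssubsets, Finset.mem_filter] at hp ⊢
    obtain ⟨hd, hu, hsu⟩ := hp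
    have hunion : p.2 \ ((σ \ s) \ p.1) ∪ σ = p.2 := by clear * - hsu; grind
    have hσ : ¬σ ⊆ p.2 \ ((σ \ s) \ p.1) := fun h => by clear * - hd h; grind
    rw [hunion]
    exact ⟨hL Finset.sdiff_subset hu, by clear * - hsu; grind, hσ, hu⟩
  · have hsτ := (Finset.mem_filter.mp hτ).2.1
    clear * - hsτ
    grind
  · simp only [Finset.mem_product, Finset.mem_ssubsets, Finset.mem_filter] at hp
    obtain ⟨hd, -, hsu⟩ := hp
    clear * - hd hsu
    ext <;> grind
  · have hsτ := (Finset.mem_filter.mp hτ).2.1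
    congr 1
    clear * - hsτ
    grind

theorem sum_stellar_insert (hσ : σ.Nonempty) (hw : {w} ∉ K.faces)
    (hL : ∀ s, s ∈ L ↔ IsSimplex K s) (hL' : ∀ s, s ∈ L' ↔ IsSimplex (stellar K σ w) s)
    (hws : w ∉ s) {M : Type*} [AddCommMonoid M] (f : Finset V → M) :
    ∑ u ∈ L' with insert w s ⊆ u, f u =
      ∑ τ ∈ L with s ⊆ τ ∧ ¬σ ⊆ τ ∧ τ ∪ σ ∈ L, f (insert w τ) := by
  have hwL : ∀ u ∈ L, w ∉ u := fun u hu => ((hL u).mp hu).notMem hw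
  symm
  refine Finset.sum_nbij' (insert w) (fun u => u.erase w) (fun τ hτ => ?_) (fun u hu => ?_)
    (fun τ hτ => ?_) (fun u hu => ?_) fun _ _ => rfl
  · obtain ⟨hτ, hsτ, hστ, hτσ⟩ := Finset.mem_filter.mp hτ
    rw [Finset.mem_filter, hL', isSimplex_stellar_insert hσ hw (hwL τ hτ), ← hL]
    exact ⟨⟨hστ, hτσ⟩, Finset.insert_subset_insert w hsτ⟩
  · obtain ⟨hu, hsu⟩ := Finset.mem_filter.mp hu
    obtain ⟨hwu, hsu⟩ := Finset.insert_subset_iff.mp hsu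
    rw [hL', ← Finset.insert_erase hwu,
      isSimplex_stellar_insert hσ hw (Finset.notMem_erase w u), ← hL] at hu
    exact Finset.mem_filter.mpr ⟨(hL _).mpr (((hL _).mp hu.2).mono Finset.subset_union_left),
      Finset.subset_erase.mpr ⟨hsu, hws⟩, hu⟩
  · exact Finset.erase_insert (hwL τ (Finset.mem_filter.mp hτ).1)
  · exact Finset.insert_erase ((Finset.mem_filter.mp hu).2 (Finset.mem_insert_self w s))

/-- The link of the new vertex is the join of `∂σ` and the link of `σ`. -/
theorem starSum_stellar_insert (hσ : σ.Nonempty) (hw : {w} ∉ K.faces)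
    (hL : ∀ s, s ∈ L ↔ IsSimplex K s) (hL' : ∀ s, s ∈ L' ↔ IsSimplex (stellar K σ w) s) {n : ℕ}
    (hn : ∀ u ∈ L, u.card ≤ n) (x t : R) (hws : w ∉ s) :
    starSum L' n x t (insert w s) =
      starSum (σ \ s).ssubsets ((σ \ s).card - 1) x t ∅ * starSum L n x t (s ∪ σ) := by
  have hlower : IsLowerSet (L : Set (Finset V)) := fun u v hvu hu =>
    (hL v).mpr (((hL u).mp hu).mono hvu)
  rw [starSum, starSum, starSum, Finset.filter_true_of_mem fun d _ => Finset.empty_subset d,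
    Finset.sum_mul_sum, ← Finset.sum_product', sum_stellar_insert hσ hw hL hL' hws,
    sum_union_mem_eq_sum_product hlower]
  refine Finset.sum_congr rfl fun p hp => ?_
  simp only [Finset.mem_product, Finset.mem_ssubsets, Finset.mem_filter] at hp
  obtain ⟨hd, hu, hsu⟩ := hp
  have hwu := ((hL p.2).mp hu).notMem hw
  have hρu : (σ \ s) \ p.1 ⊆ p.2 := by clear * - hsu; grind
  have hd_lt := Finset.card_lt_card hd
  have hρ := Finset.card_sdiff_add_card_eq_card hd.subset
  have hu_le := hn _ hu
  have hsσ_le := Finset.card_le_card hsu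
  have hsσ : (s ∪ σ).card = s.card + (σ \ s).card := by
    rw [← Finset.union_sdiff_self_eq_union, Finset.card_union_of_disjoint Finset.disjoint_sdiff]
  have hcard : (insert w (p.2 \ ((σ \ s) \ p.1))).card =
      p.2.card - ((σ \ s) \ p.1).card + 1 := by
    rw [Finset.card_insert_of_notMem (by simp [hwu]), Finset.card_sdiff_of_subset hρu]
  rw [hcard, Finset.card_insert_of_notMem hws, Finset.card_empty, hsσ, mul_mul_mul_comm, ← pow_add,
    ← pow_add]
  congr 2 <;> omega

theorem starSum_stellar (hσ : σ.Nonempty) (hw : {w} ∉ K.faces)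
    (hL : ∀ s, s ∈ L ↔ IsSimplex K s) (hL' : ∀ s, s ∈ L' ↔ IsSimplex (stellar K σ w) s) {n : ℕ}
    (hn : ∀ u ∈ L, u.card ≤ n) (x t : R) (hws : w ∉ s) :
    starSum L' n x t s = starSum L n x t s +
      (t * starSum (σ \ s).ssubsets ((σ \ s).card - 1) x t ∅ - t ^ (σ \ s).card) *
        starSum L n x t (s ∪ σ) := by
  have hfilter : L'.filter (fun u => s ⊆ u ∧ w ∉ u) = L.filter (fun u => s ⊆ u ∧ ¬σ ⊆ u) := by
    ext u
    by_cases hwu : w ∈ u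
    · have : u ∉ L := fun hu => ((hL u).mp hu).notMem hw hwu
      simp [hwu, this]
    · rw [Finset.mem_filter, Finset.mem_filter, hL, hL', isSimplex_stellar_of_notMem hσ hwu]
      tauto
  rw [starSum_eq_add_starSum_insert L' n x t hws, hfilter, starSum_sub_starSum_union,
    starSum_stellar_insert hσ hw hL hL' hn x t hws]
  ring

end StarSum

/-! ### `γ`-polynomials -/

/-- The homogeneous polynomial `∑ γ_i (α t) ^ i (α + t) ^ (d - 2 i)` of degree `d`, where `γ_i` is
the coefficient of `g` at `i`. A polytope of dimension `d` with `γ`-polynomial `g` has it as its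
`H`-polynomial. -/
def gammaExpansion (d : ℕ) (g : Polynomial ℤ) : MvPolynomial (Fin 2) ℤ :=
  ∑ i ∈ Finset.range (d / 2 + 1),
    MvPolynomial.C (g.coeff i) * (MvPolynomial.X 0 * MvPolynomial.X 1) ^ i *
      (MvPolynomial.X 0 + MvPolynomial.X 1) ^ (d - 2 * i)

theorem gammaExpansion_one (d : ℕ) :
    gammaExpansion d 1 = (MvPolynomial.X 0 + MvPolynomial.X 1) ^ d := by
  rw [gammaExpansion, Finset.sum_eq_single_of_mem 0 (by simp)]
  · simp
  · intro i _ hi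
    simp [Polynomial.coeff_one, hi]

theorem gammaExpansion_succ {d : ℕ} {g : Polynomial ℤ} (hg : g.natDegree ≤ d / 2) :
    gammaExpansion (d + 1) g = (MvPolynomial.X 0 + MvPolynomial.X 1) * gammaExpansion d g := by
  have hsub : Finset.range (d / 2 + 1) ⊆ Finset.range ((d + 1) / 2 + 1) :=
    Finset.range_subset_range.mpr (by omega)
  rw [gammaExpansion, gammaExpansion, Finset.mul_sum, ← Finset.sum_subset hsub]
  · refine Finset.sum_congr rfl fun i hi => ?_
    rw [Finset.mem_range] at hi
    rw [show d + 1 - 2 * i = d - 2 * i + 1 by omega]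
    ring
  · intro i _ hi
    rw [Finset.mem_range, not_lt] at hi
    rw [Polynomial.coeff_eq_zero_of_natDegree_lt (by omega), map_zero, zero_mul, zero_mul]

theorem gammaExpansion_add (d : ℕ) (g h : Polynomial ℤ) :
    gammaExpansion d (g + h) = gammaExpansion d g + gammaExpansion d h := by
  simp only [gammaExpansion, ← Finset.sum_add_distrib, Polynomial.coeff_add, map_add, add_mul]

theorem gammaExpansion_X_mul (d : ℕ) (h : Polynomial ℤ) :
    gammaExpansion (d + 2) (Polynomial.X * h) =
      MvPolynomial.X 0 * MvPolynomial.X 1 * gammaExpansion d h := by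
  rw [gammaExpansion, gammaExpansion, Finset.mul_sum, Nat.add_div_right d two_pos,
    Finset.sum_range_succ', Polynomial.coeff_X_mul_zero, map_zero, zero_mul, zero_mul, add_zero]
  refine Finset.sum_congr rfl fun i _ => ?_
  rw [Polynomial.coeff_X_mul, show d + 2 - 2 * (i + 1) = d - 2 * i by omega]
  ring

theorem isGammaPolynomial_iff {A : Set E} {g : Polynomial ℤ} : IsGammaPolynomial A g ↔
    g.natDegree ≤ dim A / 2 ∧ HPolynomial A = gammaExpansion (dim A) g :=
  Iff.rfl

theorem isGammaPolynomial_one_iff {A : Set E} : IsGammaPolynomial A 1 ↔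
    HPolynomial A = (MvPolynomial.X 0 + MvPolynomial.X 1) ^ dim A := by
  simp [isGammaPolynomial_iff, gammaExpansion_one]

namespace IsGammaPolynomial

variable {A B C : Set E} {g h : Polynomial ℤ}

theorem congr (hA : IsGammaPolynomial A g) (hdim : dim B = dim A)
    (hH : HPolynomial B = HPolynomial A) : IsGammaPolynomial B g := by
  rwa [isGammaPolynomial_iff, hdim, hH]

theorem of_dim_eq_add_one (hA : IsGammaPolynomial A g) (hdim : dim B = dim A + 1)
    (hH : HPolynomial B = (MvPolynomial.X 0 + MvPolynomial.X 1) * HPolynomial A) :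
    IsGammaPolynomial B g := by
  rw [isGammaPolynomial_iff] at hA ⊢
  refine ⟨by omega, ?_⟩
  rw [hdim, gammaExpansion_succ hA.1, hH, hA.2]

theorem add_X_mul (hA : IsGammaPolynomial A g) (hC : IsGammaPolynomial C h)
    (hB : dim B = dim A) (hdim : dim A = dim C + 2)
    (hH : HPolynomial B = HPolynomial A + MvPolynomial.X 0 * MvPolynomial.X 1 * HPolynomial C) :
    IsGammaPolynomial B (g + Polynomial.X * h) := by
  rw [isGammaPolynomial_iff] at hA hC ⊢
  constructor
  · have hX : (Polynomial.X * h).natDegree ≤ 1 + h.natDegree :=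
      Polynomial.natDegree_X (R := ℤ) ▸ Polynomial.natDegree_mul_le
    exact Polynomial.natDegree_add_le_of_degree_le (by omega) (by omega)
  · rw [gammaExpansion_add, hB, hdim, gammaExpansion_X_mul, ← hC.2, ← hdim, ← hA.2, hH]

end IsGammaPolynomial

/-! ### Clique complexes and cones -/

section Cone

variable {V : Type*}

/-- `K` is the complex of those cliques of the graph `G` that are contained in `W`. -/
def IsCliqueComplex (K : PreAbstractSimplicialComplex V) (G : SimpleGraph V) (W : Set V) : Prop :=
  ∀ s : Finset V, IsSimplex K s ↔ (s : Set V) ⊆ W ∧ G.IsClique s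

/-- The graph `G` with the edges at `w` replaced by those that join `w` to the elements of `U`. -/
def joinGraph (G : SimpleGraph V) (w : V) (U : Set V) : SimpleGraph V :=
  G.deleteIncidenceSet w ⊔ SimpleGraph.fromRel fun u v => u = w ∧ v ∈ U

theorem joinGraph_adj_of_ne {G : SimpleGraph V} {w : V} {U : Set V} {u v : V} (hu : u ≠ w)
    (hv : v ≠ w) : (joinGraph G w U).Adj u v ↔ G.Adj u v := by
  simp [joinGraph, SimpleGraph.deleteIncidenceSet_adj, hu, hv]

theorem joinGraph_adj_left {G : SimpleGraph V} {w : V} {U : Set V} {v : V} (hv : v ≠ w) :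
    (joinGraph G w U).Adj w v ↔ v ∈ U := by
  simp [joinGraph, SimpleGraph.deleteIncidenceSet_adj, hv, hv.symm]

theorem isClique_joinGraph_iff {G : SimpleGraph V} {w : V} {U s : Set V} (hw : w ∉ s) :
    (joinGraph G w U).IsClique s ↔ G.IsClique s :=
  have hne : ∀ v ∈ s, v ≠ w := fun _ hv h => hw (h ▸ hv)
  forall₄_congr fun u hu v hv => by rw [joinGraph_adj_of_ne (hne u hu) (hne v hv)]

theorem isClique_joinGraph_insert_iff {G : SimpleGraph V} {w : V} {U s : Set V} (hw : w ∉ s) :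
    (joinGraph G w U).IsClique (insert w s) ↔ G.IsClique s ∧ s ⊆ U := by
  have hne : ∀ v ∈ s, v ≠ w := fun _ hv h => hw (h ▸ hv)
  rw [SimpleGraph.isClique_insert, isClique_joinGraph_iff hw]
  refine and_congr_right fun _ => forall₂_congr fun v hv => ?_
  rw [joinGraph_adj_left (hne v hv), forall_prop_of_true (hne v hv).symm]

theorem fPolynomial_bot : fPolynomial (⊥ : PreAbstractSimplicialComplex V) = 1 := by
  have hfaces : (⊥ : PreAbstractSimplicialComplex V).faces = ∅ := rfl
  rw [fPolynomial, hfaces, finsum_mem_empty, add_zero]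

variable {K L : PreAbstractSimplicialComplex V} {G : SimpleGraph V} {W U : Set V}
  {s : Finset V} {w : V}

theorem fPolynomial_eq_finsum (hK : K.faces.Finite) :
    fPolynomial K = ∑ᶠ s ∈ insert ∅ K.faces, Polynomial.X ^ s.card := by
  have hempty : ∅ ∉ K.faces := fun h => (K.isRelLowerSet_faces h).1.ne_empty rfl
  rw [finsum_mem_insert _ hempty hK, Finset.card_empty, pow_zero, fPolynomial]

theorem IsCliqueComplex.le_of_subset (hL : IsCliqueComplex L G U) (hK : IsCliqueComplex K G W)
    (h : U ⊆ W) : L ≤ K := by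
  intro s hs
  have hne : s.Nonempty := (L.isRelLowerSet_faces hs).1
  change s ∈ K.faces
  rw [← isSimplex_iff_mem_faces hne, hK s]
  exact ((hL s).mp (Or.inr hs)).imp_left fun hU => hU.trans h

theorem IsCliqueComplex.joinGraph_of_notMem (hK : IsCliqueComplex K G W) (hw : w ∉ W) (U : Set V) :
    IsCliqueComplex K (joinGraph G w U) W := fun s => by
  rw [hK s]
  exact and_congr_right fun hs => (isClique_joinGraph_iff fun h => hw (hs h)).symm

variable [DecidableEq V]

theorem IsCliqueComplex.isFlag (h : IsCliqueComplex K G W) : IsFlag K := by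
  refine isFlag_iff.mpr fun s hs => (h s).mpr ⟨fun v hv => ?_, fun u hu v hv huv => ?_⟩
  · exact ((h _).mp (hs v hv v hv)).1 (by simp)
  · exact ((h _).mp (hs u hu v hv)).2 (by simp) (by simp) huv

theorem isSimplex_sup_cone_of_notMem (hLK : L ≤ K) (hws : w ∉ s) :
    IsSimplex (K ⊔ cone L w) s ↔ IsSimplex K s := by
  refine or_congr_right ⟨?_, Or.inl⟩
  rintro (h | h | h)
  · exact h
  · exact hLK h
  · exact absurd h.1 hws

theorem isSimplex_sup_cone_insert (hw : {w} ∉ K.faces) (hLK : L ≤ K) (hws : w ∉ s) :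
    IsSimplex (K ⊔ cone L w) (insert w s) ↔ IsSimplex L s := by
  have hK : insert w s ∉ K.faces := fun h =>
    IsSimplex.notMem (Or.inr h) hw (Finset.mem_insert_self w s)
  have hL : insert w s ∉ L.faces := fun h => hK (hLK h)
  rw [isSimplex_iff_mem_faces (Finset.insert_nonempty w s)]
  change insert w s ∈ K.faces ∨ (insert w s ∈ L.faces ∨ _) ↔ _
  simp [hK, hL, hws, IsSimplex]

theorem IsCliqueComplex.sup_cone (hK : IsCliqueComplex K G W) (hL : IsCliqueComplex L G (W ∩ U))
    (hw : w ∉ W) :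
    IsCliqueComplex (K ⊔ cone L w) (joinGraph G w U) (insert w W) := by
  have hLK := hL.le_of_subset hK Set.inter_subset_left
  have hwK : {w} ∉ K.faces := fun h => hw (((hK {w}).mp (Or.inr h)).1 (by simp))
  intro s
  by_cases hws : w ∈ s
  · obtain ⟨τ, hwτ, rfl⟩ : ∃ τ, w ∉ τ ∧ insert w τ = s :=
      ⟨s.erase w, Finset.notMem_erase w s, Finset.insert_erase hws⟩
    have hwτ' : w ∉ (τ : Set V) := hwτ
    rw [isSimplex_sup_cone_insert hwK hLK hwτ, hL τ, Finset.coe_insert,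
      isClique_joinGraph_insert_iff hwτ', Set.insert_subset_insert_iff hwτ', Set.subset_inter_iff]
    tauto
  · rw [isSimplex_sup_cone_of_notMem hLK hws, hK.joinGraph_of_notMem hw U s,
      Set.subset_insert_iff_of_notMem (Finset.mem_coe.not.mpr hws)]

theorem fPolynomial_sup_cone (hw : {w} ∉ K.faces) (hLK : L ≤ K) (hK : K.faces.Finite) :
    fPolynomial (K ⊔ cone L w) = fPolynomial K + Polynomial.X * fPolynomial L := by
  have hwK : ∀ s, IsSimplex K s → w ∉ s := fun s hs => hs.notMem hw
  have hwL : ∀ s ∈ insert ∅ L.faces, w ∉ s := fun s hs => hwK s (hs.imp_right (@hLK s))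
  have hfaces : (K ⊔ cone L w).faces = K.faces ∪ insert w '' insert ∅ L.faces := by
    ext s
    constructor
    · rintro (hs | hs | hs)
      · exact Or.inl hs
      · exact Or.inl (hLK hs)
      · exact Or.inr ⟨s.erase w, hs.2, Finset.insert_erase hs.1⟩
    · rintro (hs | ⟨t, ht, rfl⟩)
      · exact Or.inl hs
      · have hwt := hwL t ht
        exact (isSimplex_iff_mem_faces (Finset.insert_nonempty w t)).mp
          ((isSimplex_sup_cone_insert hw hLK hwt).mpr ht)
  have hdisj : Disjoint K.faces (insert w '' insert ∅ L.faces) := by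
    rw [Set.disjoint_left]
    rintro _ hs ⟨t, -, rfl⟩
    exact hwK _ (Or.inr hs) (Finset.mem_insert_self w t)
  have hinj : Set.InjOn (insert w) (insert ∅ L.faces) := fun s hs t ht h => by
    rw [← Finset.erase_insert (hwL s hs), ← Finset.erase_insert (hwL t ht), h]
  have hLfin : (insert ∅ L.faces).Finite := (hK.subset hLK).insert ∅
  have hcone : ∑ᶠ s ∈ insert ∅ L.faces, (Polynomial.X : Polynomial ℤ) ^ (insert w s).card =
      Polynomial.X * fPolynomial L := by
    rw [fPolynomial_eq_finsum (hK.subset hLK), mul_finsum_mem]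
    refine finsum_mem_congr rfl fun s hs => ?_
    rw [Finset.card_insert_of_notMem (hwL s hs), pow_succ']
  rw [fPolynomial, hfaces, finsum_mem_union hdisj hK (hLfin.image _), finsum_mem_image hinj, hcone,
    ← add_assoc]
  rfl

end Cone

/-! ### Simple polytopes and their dual complexes -/

theorem Face.isGLB_inter {A : Set E} (Q R : Face A) (h : (Q.1 ∩ R.1).Nonempty) :
    IsGLB {Q, R} (Q.inter R h) := by
  constructor
  · rintro B (rfl | rfl)
    · exact Set.inter_subset_left
    · exact Set.inter_subset_right
  · intro B hB
    exact Set.subset_inter (hB (by simp) : B ≤ Q) (hB (by simp) : B ≤ R)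

theorem Face.bddBelow_pair_iff {A : Set E} {Q R : Face A} :
    BddBelow {Q, R} ↔ (Q.1 ∩ R.1).Nonempty :=
  ⟨fun ⟨B, hB⟩ => B.2.1.mono (Set.subset_inter (hB (by simp) : B ≤ Q) (hB (by simp) : B ≤ R)),
    fun h => ⟨Q.inter R h, (Face.isGLB_inter Q R h).1⟩⟩

section Dual

variable {A : Set E} {K : PreAbstractSimplicialComplex ℕ} (e : DualIso A K)

/-- The simplex `σ_Q` of a face `Q`. -/
def simplexOf (Q : Face A) : Finset ℕ := (OrderDual.ofDual (e Q)).1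

theorem isSimplex_simplexOf (Q : Face A) : IsSimplex K (simplexOf e Q) :=
  (OrderDual.ofDual (e Q)).2

theorem simplexOf_subset_simplexOf_iff {Q R : Face A} :
    simplexOf e Q ⊆ simplexOf e R ↔ R ≤ Q := by
  rw [← e.le_iff_le]
  rfl

theorem simplexOf_ssubset_simplexOf_iff {Q R : Face A} :
    simplexOf e Q ⊂ simplexOf e R ↔ R < Q := by
  rw [ssubset_iff_subset_not_subset, lt_iff_le_not_ge, simplexOf_subset_simplexOf_iff,
    simplexOf_subset_simplexOf_iff]

theorem simplexOf_injective : Function.Injective (simplexOf e) := fun _ _ h =>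
  le_antisymm ((simplexOf_subset_simplexOf_iff e).mp h.ge)
    ((simplexOf_subset_simplexOf_iff e).mp h.le)

theorem isSimplex_iff_exists_simplexOf_eq {s : Finset ℕ} :
    IsSimplex K s ↔ ∃ Q, simplexOf e Q = s := by
  constructor
  · exact fun hs => ⟨e.symm (OrderDual.toDual ⟨s, hs⟩), by simp [simplexOf]⟩
  · rintro ⟨Q, rfl⟩
    exact isSimplex_simplexOf e Q

theorem isSimplex_iff_exists_subset_simplexOf {s : Finset ℕ} :
    IsSimplex K s ↔ ∃ Q, s ⊆ simplexOf e Q :=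
  ⟨fun hs => ((isSimplex_iff_exists_simplexOf_eq e).mp hs).imp fun _ h => h.ge,
    fun ⟨Q, h⟩ => (isSimplex_simplexOf e Q).mono h⟩

theorem isSimplex_union_iff {Q R : Face A} :
    IsSimplex K (simplexOf e Q ∪ simplexOf e R) ↔ BddBelow {Q, R} := by
  simp [isSimplex_iff_exists_subset_simplexOf e, Finset.union_subset_iff,
    simplexOf_subset_simplexOf_iff, BddBelow, Set.Nonempty]

theorem isSimplex_union_union_iff {Q R S : Face A} :
    IsSimplex K (simplexOf e Q ∪ simplexOf e R ∪ simplexOf e S) ↔ BddBelow {Q, R, S} := by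
  simp [isSimplex_iff_exists_subset_simplexOf e, Finset.union_subset_iff,
    simplexOf_subset_simplexOf_iff, BddBelow, Set.Nonempty]

theorem simplexOf_eq_union_iff {Q R B : Face A} :
    simplexOf e B = simplexOf e Q ∪ simplexOf e R ↔ IsGLB {Q, R} B := by
  have hlower : ∀ C, C ∈ lowerBounds {Q, R} ↔ simplexOf e Q ∪ simplexOf e R ⊆ simplexOf e C :=
    fun C => by simp [Finset.union_subset_iff, simplexOf_subset_simplexOf_iff]
  constructor
  · intro h
    refine ⟨(hlower B).mpr h.ge, fun C hC => ?_⟩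
    rw [← simplexOf_subset_simplexOf_iff e, h]
    exact (hlower C).mp hC
  · intro h
    obtain ⟨C, hC⟩ := (isSimplex_iff_exists_simplexOf_eq e).mp
      ((isSimplex_union_iff e).mpr ⟨B, h.1⟩)
    rw [← hC, ← h.unique ⟨(hlower C).mpr hC.ge, fun D hD => ?_⟩]
    rw [← simplexOf_subset_simplexOf_iff e, hC]
    exact (hlower D).mp hD

theorem isHelly_face_iff_isFlag (e : DualIso A K) : IsHelly (Face A) ↔ IsFlag K := by
  rw [isFlag_iff_isSimplex_union]
  constructor
  · intro h p q r hpq hqr hpr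
    obtain ⟨P, rfl⟩ := (isSimplex_iff_exists_simplexOf_eq e).mp (hpq.mono Finset.subset_union_left)
    obtain ⟨Q, rfl⟩ := (isSimplex_iff_exists_simplexOf_eq e).mp (hqr.mono Finset.subset_union_left)
    obtain ⟨R, rfl⟩ := (isSimplex_iff_exists_simplexOf_eq e).mp (hpr.mono Finset.subset_union_right)
    simp only [isSimplex_union_iff] at hpq hqr hpr
    exact (isSimplex_union_union_iff e).mpr (h P Q R hpq hqr hpr)
  · intro h P Q R
    simp only [← isSimplex_union_iff e, ← isSimplex_union_union_iff e]
    exact h _ _ _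

theorem IsPolytope.dim_add_card_simplexOf (hA : IsPolytope A) (Q : Face A) :
    dim Q.1 + (simplexOf e Q).card = dim A := by
  refine hA.dim_add_eq_dim (r := fun B => (simplexOf e B).card)
    (fun B C h => Finset.card_lt_card ((simplexOf_ssubset_simplexOf_iff e).mpr h))
    (fun B hB C => ?_) (fun B hB => ?_) Q
  · rw [← simplexOf_subset_simplexOf_iff e, Finset.card_eq_zero.mp hB]
    exact Finset.empty_subset _
  · obtain ⟨v, hv⟩ := Finset.card_ne_zero.mp hB
    obtain ⟨C, hC⟩ := (isSimplex_iff_exists_simplexOf_eq e).mp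
      ((isSimplex_simplexOf e B).mono (Finset.erase_subset v _))
    refine ⟨C, ?_, ?_⟩
    · rw [gt_iff_lt, ← simplexOf_ssubset_simplexOf_iff e, hC]
      exact Finset.erase_ssubset hv
    · rw [hC, Finset.card_erase_add_one hv]

theorem IsPolytope.exists_HPolynomial_eq_starSum (hA : IsPolytope A) :
    ∃ L : Finset (Finset ℕ), (∀ s, s ∈ L ↔ IsSimplex K s) ∧ (∀ s ∈ L, s.card ≤ dim A) ∧
      ∀ Q : Face A, HPolynomial Q.1 = starSum L (dim A)
        (MvPolynomial.X 0 - MvPolynomial.X 1) (MvPolynomial.X 1) (simplexOf e Q) := by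
  classical
  have := hA.finite_face
  have := Fintype.ofFinite (Face A)
  have hdim := hA.dim_add_card_simplexOf e
  refine ⟨Finset.univ.image (simplexOf e), fun s => ?_, fun s hs => ?_, fun Q => ?_⟩
  · simp [isSimplex_iff_exists_simplexOf_eq e]
  · obtain ⟨B, -, rfl⟩ := Finset.mem_image.mp hs
    exact le_of_add_le_right (hdim B).le
  · rw [hA.HPolynomial_eq, starSum, Finset.filter_image,
      Finset.sum_image (simplexOf_injective e).injOn]
    simp only [simplexOf_subset_simplexOf_iff]
    refine Finset.sum_congr rfl fun B _ => ?_
    rw [show dim A - (simplexOf e B).card = dim B.1 by have := hdim B; omega,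
      show (simplexOf e B).card - (simplexOf e Q).card = dim Q.1 - dim B.1 by
        have := hdim B; have := hdim Q; omega]

end Dual

/-! ### The faces of the cube -/

section Cube

theorem mul_le_one_add_sign_div_two_mul (c : ℝ) {y : ℝ} (hy : y ∈ Set.Icc (0 : ℝ) 1) :
    y * c ≤ (1 + (SignType.sign c : ℝ)) / 2 * c := by
  obtain ⟨h0, h1⟩ := hy
  rcases lt_trichotomy c 0 with hc | rfl | hc
  · simp only [sign_neg hc, SignType.coe_neg_one]
    nlinarith
  · simp
  · simp only [sign_pos hc, SignType.coe_one]
    nlinarith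

theorem mul_eq_mul_iff_sign_ne_zero (c y z : ℝ) :
    y * c = z * c ↔ (SignType.sign c ≠ 0 → y = z) := by
  rw [mul_eq_mul_right_iff, ← sign_eq_zero_iff]
  tauto

theorem sign_coe (a : SignType) : SignType.sign (a : ℝ) = a := by
  cases a <;> simp

variable {n : ℕ}

theorem apply_eq_sum_mul_apply_single (l : StrongDual ℝ (EuclideanSpace ℝ (Fin n)))
    (x : EuclideanSpace ℝ (Fin n)) : l x = ∑ i, x i * l (EuclideanSpace.single i 1) := by
  conv_lhs => rw [← (EuclideanSpace.basisFun (Fin n) ℝ).sum_repr x]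
  simp

/-- The face of the cube whose points have the coordinate `0` where `s` is `-1` and the coordinate
`1` where `s` is `1`. It is exposed by the functionals whose coordinates have the signs `s`. -/
def cubeFaceSet (s : Fin n → SignType) : Set (EuclideanSpace ℝ (Fin n)) :=
  {x ∈ unitCube n | ∀ i, s i ≠ 0 → x i = (1 + (s i : ℝ)) / 2}

/-- The center of the face `cubeFaceSet s`. -/
def cubeFaceCenter (s : Fin n → SignType) : EuclideanSpace ℝ (Fin n) :=
  WithLp.toLp 2 fun i => (1 + (s i : ℝ)) / 2

theorem cubeFaceCenter_mem (s : Fin n → SignType) : cubeFaceCenter s ∈ cubeFaceSet s := by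
  refine ⟨fun i => ?_, fun i _ => rfl⟩
  change (1 + (s i : ℝ)) / 2 ∈ Set.Icc (0 : ℝ) 1
  cases s i <;> norm_num

section Functional

variable (l : StrongDual ℝ (EuclideanSpace ℝ (Fin n))) {x : EuclideanSpace ℝ (Fin n)}

/-- The sign vector of a functional `l`: the face of the cube with this sign vector is the one where
`l` attains its maximum. -/
def signVector : Fin n → SignType := fun i => SignType.sign (l (EuclideanSpace.single i 1))

theorem apply_le_apply_cubeFaceCenter (hx : x ∈ unitCube n) :
    l x ≤ l (cubeFaceCenter (signVector l)) := by
  rw [apply_eq_sum_mul_apply_single l, apply_eq_sum_mul_apply_single l (cubeFaceCenter _)]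
  exact Finset.sum_le_sum fun i _ => mul_le_one_add_sign_div_two_mul _ (hx i)

theorem apply_eq_apply_cubeFaceCenter_iff (hx : x ∈ unitCube n) :
    l x = l (cubeFaceCenter (signVector l)) ↔ x ∈ cubeFaceSet (signVector l) := by
  have hle : ∀ i ∈ Finset.univ, x i * l (EuclideanSpace.single i 1) ≤
      cubeFaceCenter (signVector l) i * l (EuclideanSpace.single i 1) :=
    fun i _ => mul_le_one_add_sign_div_two_mul _ (hx i)
  rw [apply_eq_sum_mul_apply_single l, apply_eq_sum_mul_apply_single l (cubeFaceCenter _),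
    Finset.sum_eq_sum_iff_of_le hle]
  simp only [cubeFaceCenter, mul_eq_mul_iff_sign_ne_zero, Finset.mem_univ, true_imp_iff]
  exact (and_iff_right hx).symm

theorem setOf_apply_eq_apply_cubeFaceCenter :
    {x ∈ unitCube n | l x = l (cubeFaceCenter (signVector l))} = cubeFaceSet (signVector l) := by
  ext x
  exact ⟨fun hx => (apply_eq_apply_cubeFaceCenter_iff l hx.1).mp hx.2,
    fun hx => ⟨hx.1, (apply_eq_apply_cubeFaceCenter_iff l hx.1).mpr hx⟩⟩

end Functional

theorem exists_signVector_eq (s : Fin n → SignType) :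
    ∃ l : StrongDual ℝ (EuclideanSpace ℝ (Fin n)), signVector l = s := by
  refine ⟨innerSL ℝ (WithLp.toLp 2 fun i => (s i : ℝ)), funext fun i => ?_⟩
  simp [signVector, EuclideanSpace.inner_single_right, sign_coe]

/-- `cubeFaceSet s` as a face of the cube. -/
def cubeFace (s : Fin n → SignType) : Face (unitCube n) :=
  ⟨cubeFaceSet s, ⟨_, cubeFaceCenter_mem s⟩, by
    obtain ⟨l, rfl⟩ := exists_signVector_eq s
    rw [← setOf_apply_eq_apply_cubeFaceCenter]
    exact isExposed_setOf_eq (cubeFaceCenter_mem _).1 fun x => apply_le_apply_cubeFaceCenter l⟩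

theorem cubeFace_le_cubeFace_iff {u s : Fin n → SignType} :
    cubeFace u ≤ cubeFace s ↔ ∀ i, s i ≠ 0 → u i = s i := by
  constructor
  · intro h i hi
    have hcenter : (1 + (u i : ℝ)) / 2 = (1 + (s i : ℝ)) / 2 := (h (cubeFaceCenter_mem u)).2 i hi
    rw [← sign_coe (u i), ← sign_coe (s i), show (u i : ℝ) = s i by linarith]
  · exact fun h x hx => ⟨hx.1, fun i hi => h i hi ▸ hx.2 i (by rwa [h i hi])⟩

theorem cubeFace_bijective : Function.Bijective (cubeFace (n := n)) := by
  refine ⟨fun s u h => funext fun i => ?_, fun ⟨B, hne, hB⟩ => ?_⟩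
  · have hus := cubeFace_le_cubeFace_iff.mp h.le i
    have hsu := cubeFace_le_cubeFace_iff.mp h.ge i
    grind
  · obtain ⟨l, rfl⟩ := hB hne
    refine ⟨signVector l, Subtype.ext ?_⟩
    change cubeFaceSet _ = {x ∈ unitCube n | ∀ y ∈ unitCube n, l y ≤ l x}
    rw [← setOf_apply_eq_apply_cubeFaceCenter]
    ext x
    refine and_congr_right fun hx => ⟨fun h y hy => ?_, fun h => ?_⟩
    · exact (apply_le_apply_cubeFaceCenter l hy).trans_eq h.symm
    · exact (apply_le_apply_cubeFaceCenter l hx).antisymm (h _ (cubeFaceCenter_mem _).1)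

theorem isHelly_face_unitCube : IsHelly (Face (unitCube n)) := by
  have hcompat : ∀ {p q : Fin n → SignType}, BddBelow {cubeFace p, cubeFace q} →
      ∀ i, p i ≠ 0 → q i ≠ 0 → p i = q i := by
    rintro p q ⟨B, hB⟩ i hp hq
    obtain ⟨d, rfl⟩ := cubeFace_bijective.2 B
    rw [← cubeFace_le_cubeFace_iff.mp (hB (Or.inl rfl)) i hp,
      cubeFace_le_cubeFace_iff.mp (hB (Or.inr rfl)) i hq]
  simp only [IsHelly, cubeFace_bijective.2.forall]
  intro a b c hab hbc hac
  refine ⟨cubeFace fun i => if a i ≠ 0 then a i else if b i ≠ 0 then b i else c i, ?_⟩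
  rintro _ (rfl | rfl | rfl) <;> refine cubeFace_le_cubeFace_iff.mpr fun i hi => ?_
  · rw [if_pos hi]
  · have := hcompat hab i
    grind
  · have := hcompat hac i
    have := hcompat hbc i
    grind

end Cube

section CombinatorialCube

variable {n : ℕ}

/-- The coordinates that vary on the face of the cube with sign vector `s`. -/
def freeCoords (s : Fin n → SignType) : Finset (Fin n) := {i | s i = 0}

theorem mem_freeCoords {s : Fin n → SignType} {i : Fin n} : i ∈ freeCoords s ↔ s i = 0 := by
  simp [freeCoords]

theorem freeCoords_subset_of_cubeFace_le {u s : Fin n → SignType} (h : cubeFace u ≤ cubeFace s) :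
    freeCoords u ⊆ freeCoords s := fun i hi => by
  have := cubeFace_le_cubeFace_iff.mp h i
  rw [mem_freeCoords] at hi ⊢
  grind

theorem freeCoords_ssubset_of_cubeFace_lt {u s : Fin n → SignType} (h : cubeFace u < cubeFace s) :
    freeCoords u ⊂ freeCoords s := by
  refine (freeCoords_subset_of_cubeFace_le h.le).ssubset_of_ne fun heq => h.not_ge ?_
  refine cubeFace_le_cubeFace_iff.mpr fun i hi => (cubeFace_le_cubeFace_iff.mp h.le i ?_).symm
  rwa [ne_eq, ← mem_freeCoords, ← heq, mem_freeCoords]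

theorem exists_cubeFace_lt_of_notMem_freeCoords {s : Fin n → SignType} {i : Fin n}
    (hi : i ∉ freeCoords s) :
    ∃ u, cubeFace s < cubeFace u ∧ freeCoords u = insert i (freeCoords s) := by
  have hfree : freeCoords (Function.update s i 0) = insert i (freeCoords s) := by
    ext j
    rw [Finset.mem_insert, mem_freeCoords, mem_freeCoords, Function.update_apply]
    grind
  refine ⟨Function.update s i 0,
    lt_of_le_of_ne (cubeFace_le_cubeFace_iff.mpr fun j hj => ?_) fun h => ?_, hfree⟩
  · grind
  · rw [← cubeFace_bijective.1 h] at hfree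
    exact hi (hfree ▸ Finset.mem_insert_self i _)

theorem sum_cubeFace_le {R : Type*} [CommRing R] (x t : R) (s : Fin n → SignType)
    [DecidablePred fun u => cubeFace u ≤ cubeFace s] :
    ∑ u with cubeFace u ≤ cubeFace s,
      x ^ (freeCoords u).card * t ^ ((freeCoords s).card - (freeCoords u).card) =
        (x + 2 * t) ^ (freeCoords s).card := by
  have hpi : ({u | cubeFace u ≤ cubeFace s} : Finset (Fin n → SignType)) =
      Fintype.piFinset fun i => if s i = 0 then Finset.univ else {s i} := by
    ext u
    simp only [Finset.mem_filter, Finset.mem_univ, true_and, Fintype.mem_piFinset,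
      cubeFace_le_cubeFace_iff]
    refine forall_congr' fun i => ?_
    split_ifs with hi <;> simp [hi]
  have hterm : ∀ u, cubeFace u ≤ cubeFace s →
      x ^ (freeCoords u).card * t ^ ((freeCoords s).card - (freeCoords u).card) =
        ∏ i, if u i = 0 then x else if s i = 0 then t else 1 := fun u hu => by
    rw [Finset.prod_ite, Finset.prod_const, Finset.prod_ite, Finset.prod_const,
      Finset.prod_const_one, mul_one,
      ← Finset.card_sdiff_of_subset (freeCoords_subset_of_cubeFace_le hu), freeCoords, freeCoords]
    congr 3
    grind
  have hfactor : ∀ i, ∑ a ∈ if s i = 0 then Finset.univ else {s i},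
      (if a = 0 then x else if s i = 0 then t else 1) = if s i = 0 then x + 2 * t else 1 :=
    fun i => by
      split_ifs with hi
      · simp [SignType.univ_eq, two_mul]
      · simp [hi]
  rw [Finset.sum_congr rfl fun u hu => hterm u (Finset.mem_filter.mp hu).2, hpi,
    ← Finset.prod_univ_sum _ fun i a => if a = 0 then x else if s i = 0 then t else 1,
    Finset.prod_congr rfl fun i _ => hfactor i, Finset.prod_ite, Finset.prod_const,
    Finset.prod_const_one, mul_one, freeCoords]

theorem dim_symm_cubeFace {A : Set E} (hA : IsPolytope A) (hdim : dim A = n)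
    (e : Face A ≃o Face (unitCube n)) (s : Fin n → SignType) :
    dim (e.symm (cubeFace s)).1 = (freeCoords s).card := by
  let f : (Fin n → SignType) ≃ Face A :=
    (Equiv.ofBijective cubeFace cubeFace_bijective).trans e.symm.toEquiv
  have hlt : ∀ {u s}, f u < f s ↔ cubeFace u < cubeFace s := e.symm.lt_iff_lt
  have key := hA.dim_add_eq_dim (r := fun B => (freeCoords (f.symm B))ᶜ.card) ?_ ?_ ?_ (f s)
  · rw [f.symm_apply_apply, Finset.card_compl, Fintype.card_fin, hdim] at key
    have := (freeCoords s).card_le_univ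
    rw [Fintype.card_fin] at this
    exact Nat.add_right_cancel (key.trans (Nat.add_sub_of_le this).symm)
  all_goals simp only [StrictAnti, f.surjective.forall, f.surjective.exists, f.symm_apply_apply]
  · exact fun u s h => Finset.card_lt_card
      (compl_lt_compl_iff_lt.mpr (freeCoords_ssubset_of_cubeFace_lt (hlt.mp h)))
  · refine fun s hs => f.surjective.forall.mpr fun u => e.symm.le_iff_le.mpr ?_
    rw [Finset.card_eq_zero, Finset.compl_eq_empty_iff] at hs
    exact cubeFace_le_cubeFace_iff.mpr fun i hi =>
      absurd (mem_freeCoords.mp (hs ▸ Finset.mem_univ i)) hi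
  · intro s hs
    obtain ⟨i, hi⟩ := Finset.card_ne_zero.mp hs
    obtain ⟨u, hlt', hu⟩ := exists_cubeFace_lt_of_notMem_freeCoords (Finset.mem_compl.mp hi)
    refine ⟨u, hlt.mpr hlt', ?_⟩
    rw [hu, Finset.compl_insert, Finset.card_erase_add_one hi]

theorem isGammaPolynomial_one_of_orderIso_unitCube {A : Set E} (hA : IsPolytope A)
    (hdim : dim A = n) (e : Face A ≃o Face (unitCube n)) (Q : Face A) :
    IsGammaPolynomial Q.1 1 := by
  classical
  have := hA.finite_face
  have := Fintype.ofFinite (Face A)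
  have hbij : Function.Bijective fun u : Fin n → SignType => e.symm (cubeFace u) :=
    e.symm.bijective.comp cubeFace_bijective
  obtain ⟨s, rfl⟩ := hbij.2 Q
  rw [isGammaPolynomial_one_iff, hA.HPolynomial_eq, Finset.sum_filter, ← hbij.sum_comp]
  simp only [dim_symm_cubeFace hA hdim, e.symm.le_iff_le]
  rw [← Finset.sum_filter, sum_cubeFace_le]
  congr 1
  ring

end CombinatorialCube

/-! ### Truncations -/

theorem card_sdiff_eq_one {V : Type*} [DecidableEq V] {σ s : Finset V} (hσ : σ.card = 2)
    (hsub : ¬σ ⊆ s) (hdisj : ¬Disjoint s σ) : (σ \ s).card = 1 := by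
  have hinter : (s ∩ σ).card ≠ 0 := by
    rwa [Finset.card_ne_zero, ← Finset.not_disjoint_iff_nonempty_inter]
  have hsdiff : (σ \ s).card ≠ 0 := by rwa [Finset.card_ne_zero, Finset.sdiff_nonempty]
  have := Finset.card_sdiff_add_card_inter σ s
  rw [Finset.inter_comm] at this
  omega

namespace Truncation

open MvPolynomial (X)

variable {n : ℕ} {P P' : ConvexPolytope E n} (T : Truncation P P') {Q' : Face P'.carrier}

theorem simplexOf_oldFace_of_notMem (h : T.w ∉ simplexOf T.e' Q') :
    simplexOf T.e (T.oldFace Q') = simplexOf T.e' Q' := by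
  have h' : T.w ∉ T.simplex' Q' := h
  rw [oldFace, dif_neg h']
  simp [simplexOf, simplex']

theorem simplexOf_oldFace_of_eq_insert {τ : Finset ℕ} (hτ : T.w ∉ τ)
    (h : simplexOf T.e' Q' = insert T.w τ) : simplexOf T.e (T.oldFace Q') = τ ∪ T.σ := by
  have h' : T.simplex' Q' = insert T.w τ := h
  have hmem : T.w ∈ T.simplex' Q' := h' ▸ Finset.mem_insert_self _ _
  rw [oldFace, dif_pos hmem]
  simp [simplexOf, h', Finset.erase_insert hτ]

theorem simplexOf_oldFace (Q' : Face P'.carrier) : simplexOf T.e (T.oldFace Q') =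
    if T.w ∈ simplexOf T.e' Q' then (simplexOf T.e' Q').erase T.w ∪ T.σ else simplexOf T.e' Q' := by
  split_ifs with h
  · exact T.simplexOf_oldFace_of_eq_insert (Finset.notMem_erase _ _) (Finset.insert_erase h).symm
  · exact T.simplexOf_oldFace_of_notMem h

theorem isGLB_oldFace {A B C : Face P'.carrier} (h : IsGLB {A, B} C) :
    IsGLB {T.oldFace A, T.oldFace B} (T.oldFace C) := by
  rw [← simplexOf_eq_union_iff T.e'] at h
  rw [← simplexOf_eq_union_iff T.e]
  simp only [simplexOf_oldFace, h]
  clear * -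
  grind

/-- The face `Q'` arises from a face `Q` of `P` for which `G ∩ Q` is a nonempty face of codimension
2 of `Q`. On simplices this says that `σ_Q` and `σ_G` are disjoint and lie in a common simplex. -/
def Cuts (Q' : Face P'.carrier) : Prop :=
  Disjoint (simplexOf T.e (T.oldFace Q')) T.σ ∧ IsSimplex T.K (simplexOf T.e (T.oldFace Q') ∪ T.σ)

theorem cuts_iff_of_isGLB (hP : IsHelly (Face P.carrier)) {A B C : Face P'.carrier}
    (h : IsGLB {A, B} C) : T.Cuts C ↔ T.Cuts A ∧ T.Cuts B := by
  have hflag := isFlag_iff_isSimplex_union.mp ((isHelly_face_iff_isFlag T.e).mp hP)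
  have hC := isSimplex_simplexOf T.e (T.oldFace C)
  unfold Cuts
  rw [(simplexOf_eq_union_iff T.e).mpr (T.isGLB_oldFace h)] at hC ⊢
  rw [Finset.disjoint_union_left]
  constructor
  · rintro ⟨⟨hA, hB⟩, hs⟩
    exact ⟨⟨hA, hs.mono (Finset.union_subset_union_left Finset.subset_union_left)⟩,
      ⟨hB, hs.mono (Finset.union_subset_union_left Finset.subset_union_right)⟩⟩
  · rintro ⟨⟨hA, hsA⟩, hB, hsB⟩
    exact ⟨⟨hA, hB⟩, hflag _ _ _ hC hsB hsA⟩

theorem card_σ : T.σ.card = 2 := by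
  have hcard : dim T.G.1 + T.σ.card = dim P.carrier :=
    P.isPolytope.dim_add_card_simplexOf T.e T.G
  have := T.codim_G
  have := P.dim_eq
  omega

theorem σ_nonempty : T.σ.Nonempty := Finset.card_pos.mp (T.card_σ ▸ two_pos)

theorem isSimplex_stellar_simplexOf (Q' : Face P'.carrier) :
    IsSimplex (stellar T.K T.σ T.w) (simplexOf T.e' Q') :=
  isSimplex_simplexOf T.e' Q'

theorem isHelly (T : Truncation P P') (h : IsHelly (Face P.carrier)) :
    IsHelly (Face P'.carrier) := by
  have hσ : T.σ ∈ T.K.faces :=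
    (isSimplex_iff_mem_faces T.σ_nonempty).mp (isSimplex_simplexOf T.e T.G)
  exact (isHelly_face_iff_isFlag T.e').mpr
    (((isHelly_face_iff_isFlag T.e).mp h).isFlag_stellar hσ T.card_σ T.w_new)

theorem isGLB_inter_oldFace (hne : (T.G.1 ∩ (T.oldFace Q').1).Nonempty) :
    IsGLB {T.oldFace Q', T.G} (T.G.inter (T.oldFace Q') hne) := by
  rw [Set.pair_comm]
  exact Face.isGLB_inter _ _ hne

theorem simplexOf_eq_union_σ_iff {Q R : Face P.carrier} :
    simplexOf T.e R = simplexOf T.e Q ∪ T.σ ↔ IsGLB {Q, T.G} R :=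
  simplexOf_eq_union_iff T.e

theorem dim_add_two_eq_iff {Q R : Face P.carrier} (h : IsGLB {Q, T.G} R) :
    dim R.1 + 2 = dim Q.1 ↔ Disjoint (simplexOf T.e Q) T.σ := by
  have hQ := P.isPolytope.dim_add_card_simplexOf T.e Q
  have hR := P.isPolytope.dim_add_card_simplexOf T.e R
  have hσ := T.card_σ
  rw [T.simplexOf_eq_union_σ_iff.mpr h] at hR
  rw [← Finset.card_union_eq_card_add_card, hσ]
  omega

theorem step_of_cuts (Δ : Face P.carrier → PreAbstractSimplicialComplex ℕ) (v : ℕ)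
    (h : T.Cuts Q') : ∃ R : Face P.carrier, IsGLB {T.oldFace Q', T.G} R ∧
      T.step Δ v Q' = Δ (T.oldFace Q') ⊔ cone (Δ R) v := by
  have hne : (T.G.1 ∩ (T.oldFace Q').1).Nonempty := by
    rw [Set.inter_comm, ← Face.bddBelow_pair_iff, ← isSimplex_union_iff T.e]
    exact h.2
  have hR := T.isGLB_inter_oldFace hne
  refine ⟨_, hR, ?_⟩
  rw [step, dif_pos hne]
  exact if_pos ((T.dim_add_two_eq_iff hR).mpr h.1)

theorem step_of_not_cuts (Δ : Face P.carrier → PreAbstractSimplicialComplex ℕ) (v : ℕ)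
    (h : ¬T.Cuts Q') : T.step Δ v Q' = Δ (T.oldFace Q') := by
  rw [step]
  split_ifs with hne hdim
  · have hR := T.isGLB_inter_oldFace hne
    refine absurd ⟨(T.dim_add_two_eq_iff hR).mp hdim, ?_⟩ h
    exact (isSimplex_union_iff T.e).mpr ⟨_, hR.1⟩
  · rfl
  · rfl

theorem dim_of_notMem (h : T.w ∉ simplexOf T.e' Q') : dim Q'.1 = dim (T.oldFace Q').1 := by
  have hQ := P.isPolytope.dim_add_card_simplexOf T.e (T.oldFace Q')
  have hQ' := P'.isPolytope.dim_add_card_simplexOf T.e' Q'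
  rw [T.simplexOf_oldFace_of_notMem h, P.dim_eq] at hQ
  rw [P'.dim_eq] at hQ'
  omega

theorem dim_add_one_eq_of_eq_insert {τ : Finset ℕ} (hτ : T.w ∉ τ)
    (h : simplexOf T.e' Q' = insert T.w τ) :
    dim Q'.1 + 1 = dim (T.oldFace Q').1 + (T.σ \ τ).card := by
  have hQ := P.isPolytope.dim_add_card_simplexOf T.e (T.oldFace Q')
  have hQ' := P'.isPolytope.dim_add_card_simplexOf T.e' Q'
  rw [T.simplexOf_oldFace_of_eq_insert hτ h, P.dim_eq, Finset.union_comm,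
    ← Finset.card_sdiff_add_card] at hQ
  rw [h, Finset.card_insert_of_notMem hτ, P'.dim_eq] at hQ'
  omega

theorem exists_HPolynomial_eq : ∃ F : Finset ℕ → MvPolynomial (Fin 2) ℤ,
    (∀ Q : Face P.carrier, HPolynomial Q.1 = F (simplexOf T.e Q)) ∧
    (∀ s, ¬IsSimplex T.K s → F s = 0) ∧
    (∀ Q' : Face P'.carrier, ∀ s, T.w ∉ s → simplexOf T.e' Q' = s →
      HPolynomial Q'.1 = F s + (X 1 * starSum (T.σ \ s).ssubsets ((T.σ \ s).card - 1)
        (X 0 - X 1) (X 1) ∅ - X 1 ^ (T.σ \ s).card) * F (s ∪ T.σ)) ∧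
    ∀ Q' : Face P'.carrier, ∀ s, T.w ∉ s → simplexOf T.e' Q' = insert T.w s →
      HPolynomial Q'.1 = starSum (T.σ \ s).ssubsets ((T.σ \ s).card - 1)
        (X 0 - X 1) (X 1) ∅ * F (s ∪ T.σ) := by
  obtain ⟨L, hL, hcard, hH⟩ := P.isPolytope.exists_HPolynomial_eq_starSum T.e
  obtain ⟨L', hL', -, hH'⟩ := P'.isPolytope.exists_HPolynomial_eq_starSum T.e'
  rw [P.dim_eq] at hcard hH
  rw [P'.dim_eq] at hH'
  refine ⟨starSum L n (X 0 - X 1) (X 1), hH, fun s => starSum_eq_zero hL _ _ _,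
    fun Q' s hs h => ?_, fun Q' s hs h => ?_⟩
  · rw [hH', h, starSum_stellar T.σ_nonempty T.w_new hL hL' hcard _ _ hs]
  · rw [hH', h, starSum_stellar_insert T.σ_nonempty T.w_new hL hL' hcard _ _ hs]

theorem notMem_of_cuts (h : T.Cuts Q') : T.w ∉ simplexOf T.e' Q' := fun hmem => by
  have hdisj := h.1
  rw [simplexOf_oldFace, if_pos hmem, Finset.disjoint_union_left, disjoint_self] at hdisj
  exact T.σ_nonempty.ne_empty hdisj.2

theorem isGammaPolynomial_of_cuts {R : Face P.carrier} {g h : Polynomial ℤ} (hc : T.Cuts Q')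
    (hR : IsGLB {T.oldFace Q', T.G} R) (hg : IsGammaPolynomial (T.oldFace Q').1 g)
    (hh : IsGammaPolynomial R.1 h) : IsGammaPolynomial Q'.1 (g + Polynomial.X * h) := by
  obtain ⟨F, hF, -, hH', -⟩ := T.exists_HPolynomial_eq
  have hw := T.notMem_of_cuts hc
  have hs := T.simplexOf_oldFace_of_notMem hw
  have hsdiff : T.σ \ simplexOf T.e (T.oldFace Q') = T.σ := sdiff_eq_left.mpr hc.1.symm
  refine hg.add_X_mul hh (T.dim_of_notMem hw) ((T.dim_add_two_eq_iff hR).mpr hc.1).symm ?_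
  rw [hH' Q' _ (hs ▸ hw) hs.symm, hF, hF, T.simplexOf_eq_union_σ_iff.mpr hR, hsdiff,
    T.card_σ, starSum_ssubsets_of_card_eq_two T.card_σ]
  ring

theorem HPolynomial_of_not_cuts_of_notMem (hc : ¬T.Cuts Q') (hw : T.w ∉ simplexOf T.e' Q') :
    HPolynomial Q'.1 = HPolynomial (T.oldFace Q').1 := by
  obtain ⟨F, hF, hzero, hH', -⟩ := T.exists_HPolynomial_eq
  have hs := T.simplexOf_oldFace_of_notMem hw
  have hsub := ((isSimplex_stellar_of_notMem T.σ_nonempty hw).mp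
    (T.isSimplex_stellar_simplexOf Q')).2
  rw [hH' Q' _ hw rfl, hF, hs, add_eq_left]
  by_cases hdisj : Disjoint (simplexOf T.e' Q') T.σ
  · rw [hzero _ fun h => hc ⟨hs ▸ hdisj, hs ▸ h⟩, mul_zero]
  · have hcard := card_sdiff_eq_one T.card_σ hsub hdisj
    rw [starSum_ssubsets_of_card_eq_one hcard, hcard]
    ring

theorem isGammaPolynomial_of_mem {g : Polynomial ℤ} (hw : T.w ∈ simplexOf T.e' Q')
    (hg : IsGammaPolynomial (T.oldFace Q').1 g) : IsGammaPolynomial Q'.1 g := by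
  obtain ⟨F, hF, -, -, hH'⟩ := T.exists_HPolynomial_eq
  obtain ⟨τ, hwτ, hτ⟩ : ∃ τ, T.w ∉ τ ∧ simplexOf T.e' Q' = insert T.w τ :=
    ⟨_, Finset.notMem_erase _ _, (Finset.insert_erase hw).symm⟩
  have hH := hH' Q' τ hwτ hτ
  rw [← T.simplexOf_oldFace_of_eq_insert hwτ hτ, ← hF] at hH
  have hdim := T.dim_add_one_eq_of_eq_insert hwτ hτ
  have hsub := ((isSimplex_stellar_insert T.σ_nonempty T.w_new hwτ).mp
    (hτ ▸ T.isSimplex_stellar_simplexOf Q')).1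
  by_cases hdisj : Disjoint τ T.σ
  · rw [sdiff_eq_left.mpr hdisj.symm, T.card_σ] at hH hdim
    rw [starSum_ssubsets_of_card_eq_two T.card_σ] at hH
    refine hg.of_dim_eq_add_one (by omega) (hH.trans ?_)
    ring
  · have hcard := card_sdiff_eq_one T.card_σ hsub hdisj
    rw [hcard] at hH hdim
    rw [starSum_ssubsets_of_card_eq_one hcard, pow_zero, one_mul] at hH
    exact hg.congr (by omega) hH

theorem isGammaPolynomial_of_not_cuts {g : Polynomial ℤ} (hc : ¬T.Cuts Q')
    (hg : IsGammaPolynomial (T.oldFace Q').1 g) : IsGammaPolynomial Q'.1 g := by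
  by_cases hw : T.w ∈ simplexOf T.e' Q'
  · exact T.isGammaPolynomial_of_mem hw hg
  · exact hg.congr (T.dim_of_notMem hw) (T.HPolynomial_of_not_cuts_of_notMem hc hw)

end Truncation

/-! ### The complexes `Δ(Q)` -/

/-- The complexes `Δ(Q)` are clique complexes of one and the same graph `G`, on vertex sets `W(Q)`
that turn intersections of faces into intersections. -/
structure IsCliqueFamily {A : Set E} (Δ : Face A → PreAbstractSimplicialComplex ℕ)
    (G : SimpleGraph ℕ) (W : Face A → Set ℕ) : Prop where
  isCliqueComplex : ∀ Q, IsCliqueComplex (Δ Q) G (W Q)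
  eq_inter : ∀ {Q R B}, IsGLB {Q, R} B → W B = W Q ∩ W R

section Step

variable {n m : ℕ} {P P' : ConvexPolytope E n}
  {Δ : Face P.carrier → PreAbstractSimplicialComplex ℕ} {G : SimpleGraph ℕ}
  {W : Face P.carrier → Set ℕ}

open scoped Classical in
/-- The vertex sets of the complexes `T.step Δ v`, if `W` are those of the complexes `Δ`. -/
def Truncation.vertexSet (T : Truncation P P') (W : Face P.carrier → Set ℕ) (v : ℕ)
    (Q' : Face P'.carrier) : Set ℕ :=
  if T.Cuts Q' then insert v (W (T.oldFace Q')) else W (T.oldFace Q')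

theorem Truncation.vertexSet_eq_inter (T : Truncation P P') {v : ℕ}
    (hP : IsHelly (Face P.carrier)) (hW : ∀ {Q R B}, IsGLB {Q, R} B → W B = W Q ∩ W R)
    (hv : ∀ Q, v ∉ W Q) {Q' R' B' : Face P'.carrier} (h : IsGLB {Q', R'} B') :
    T.vertexSet W v B' = T.vertexSet W v Q' ∩ T.vertexSet W v R' := by
  have hQ := hv (T.oldFace Q')
  have hR := hv (T.oldFace R')
  have hcB := T.cuts_iff_of_isGLB hP h
  by_cases hcQ : T.Cuts Q' <;> by_cases hcR : T.Cuts R' <;>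
    simp only [hcQ, hcR, and_self, and_true, and_false] at hcB <;>
    simp only [vertexSet, hcQ, hcR, hcB, if_true, if_false, hW (T.isGLB_oldFace h)]
  · rw [Set.insert_inter_distrib]
  · rw [Set.insert_inter_of_notMem hR]
  · rw [Set.inter_insert_of_notMem hQ]

theorem IsCliqueFamily.step (h : IsCliqueFamily Δ G W) (T : Truncation P P')
    (hP : IsHelly (Face P.carrier)) {v : ℕ} (hv : ∀ Q, v ∉ W Q) :
    IsCliqueFamily (T.step Δ v) (joinGraph G v (W T.G)) (T.vertexSet W v) where
  isCliqueComplex Q' := by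
    by_cases hc : T.Cuts Q'
    · obtain ⟨R, hR, hstep⟩ := T.step_of_cuts Δ v hc
      rw [hstep, Truncation.vertexSet, if_pos hc]
      exact (h.isCliqueComplex _).sup_cone (h.eq_inter hR ▸ h.isCliqueComplex R) (hv _)
    · rw [T.step_of_not_cuts Δ v hc, Truncation.vertexSet, if_neg hc]
      exact (h.isCliqueComplex _).joinGraph_of_notMem (hv _) _
  eq_inter := T.vertexSet_eq_inter hP h.eq_inter hv

/-- The properties of the complexes `Δ(Q)` that are propagated along a sequence of `m` truncations
leading from a cube to `P`. -/
structure IsGammaFamily (P : ConvexPolytope E n) (m : ℕ)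
    (Δ : Face P.carrier → PreAbstractSimplicialComplex ℕ) : Prop where
  isHelly : IsHelly (Face P.carrier)
  exists_isCliqueFamily : ∃ G W, IsCliqueFamily Δ G W ∧ ∀ Q, W Q ⊆ Set.Iio m
  isGammaPolynomial : ∀ Q : Face P.carrier, IsGammaPolynomial Q.1 (fPolynomial (Δ Q))

namespace IsGammaFamily

theorem subset_range (h : IsGammaFamily P m Δ) (Q : Face P.carrier) :
    ∀ s ∈ (Δ Q).faces, s ⊆ Finset.range m := by
  obtain ⟨G, W, hΔ, hW⟩ := h.exists_isCliqueFamily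
  exact fun s hs v hv =>
    Finset.mem_range.mpr (hW Q (((hΔ.isCliqueComplex Q s).mp (Or.inr hs)).1 hv))

theorem finite_faces (h : IsGammaFamily P m Δ) (Q : Face P.carrier) : (Δ Q).faces.Finite :=
  (Finset.range m).powerset.finite_toSet.subset fun s hs =>
    Finset.mem_coe.mpr (Finset.mem_powerset.mpr (h.subset_range Q s hs))

theorem isFlag (h : IsGammaFamily P m Δ) (Q : Face P.carrier) : IsFlag (Δ Q) := by
  obtain ⟨G, W, hΔ, -⟩ := h.exists_isCliqueFamily
  exact (hΔ.isCliqueComplex Q).isFlag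

theorem cube (e : Face P.carrier ≃o Face (unitCube n)) : IsGammaFamily P 0 fun _ => ⊥ where
  isHelly := isHelly_face_unitCube.of_orderIso e.symm
  exists_isCliqueFamily := by
    have hbot : IsCliqueComplex (⊥ : PreAbstractSimplicialComplex ℕ) ⊥ ∅ := fun s => by
      rw [Set.subset_empty_iff, Finset.coe_eq_empty]
      exact ⟨fun hs => hs.elim (fun h => ⟨h, by simp [h]⟩) False.elim, fun hs => Or.inl hs.1⟩
    exact ⟨⊥, fun _ => ∅, ⟨fun _ => hbot, fun _ => (Set.inter_self ∅).symm⟩,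
      fun _ => Set.empty_subset _⟩
  isGammaPolynomial Q := by
    rw [fPolynomial_bot]
    exact isGammaPolynomial_one_of_orderIso_unitCube P.isPolytope P.dim_eq e Q

theorem step (h : IsGammaFamily P m Δ) (T : Truncation P P') :
    IsGammaFamily P' (m + 1) (T.step Δ m) := by
  obtain ⟨G, W, hΔ, hW⟩ := h.exists_isCliqueFamily
  have hm : ∀ Q, m ∉ W Q := fun Q hmem => (Set.mem_Iio.mp (hW Q hmem)).false
  have hWsucc : ∀ Q, W Q ⊆ Set.Iio (m + 1) := fun Q =>
    (hW Q).trans (Set.Iio_subset_Iio m.le_succ)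
  refine ⟨T.isHelly h.isHelly, ⟨_, _, hΔ.step T h.isHelly hm, fun Q' => ?_⟩, fun Q' => ?_⟩
  · rw [Truncation.vertexSet]
    split_ifs
    · exact Set.insert_subset (Set.mem_Iio.mpr m.lt_succ_self) (hWsucc _)
    · exact hWsucc _
  · by_cases hc : T.Cuts Q'
    · obtain ⟨R, hR, hstep⟩ := T.step_of_cuts Δ m hc
      have hle : Δ R ≤ Δ (T.oldFace Q') := (hΔ.isCliqueComplex R).le_of_subset
        (hΔ.isCliqueComplex _) (hΔ.eq_inter hR ▸ Set.inter_subset_left)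
      have hnew : {m} ∉ (Δ (T.oldFace Q')).faces := fun hmem => by
        simpa using h.subset_range _ _ hmem
      rw [hstep, fPolynomial_sup_cone hnew hle (h.finite_faces _)]
      exact T.isGammaPolynomial_of_cuts hc hR (h.isGammaPolynomial _) (h.isGammaPolynomial R)
    · rw [T.step_of_not_cuts Δ m hc]
      exact T.isGammaPolynomial_of_not_cuts hc (h.isGammaPolynomial _)

end IsGammaFamily

theorem TruncationSequence.isGammaFamily (S : TruncationSequence P m) :
    IsGammaFamily P m S.Δ := by
  induction S with
  | cube P e => exact .cube e
  | truncate S P' T ih => exact ih.step T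

end Step

end TwoTruncatedCube

end

theorem mainTheorem1_general {E : Type*} [NormedAddCommGroup E] [NormedSpace ℝ E]
    {n : ℕ} (P : TwoTruncatedCube.ConvexPolytope E n)
    (hP : TwoTruncatedCube.IsTwoTruncatedCube P) :
    (∃ Δ : PreAbstractSimplicialComplex ℕ, Δ.faces.Finite ∧ TwoTruncatedCube.IsFlag Δ ∧
      TwoTruncatedCube.IsGammaPolynomial P.carrier (TwoTruncatedCube.fPolynomial Δ)) ∧
    ∀ (m : ℕ) (S : TwoTruncatedCube.TruncationSequence P m)
      (Q : TwoTruncatedCube.Face P.carrier),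
      (∀ s ∈ (S.Δ Q).faces, s ⊆ Finset.range m) ∧
      TwoTruncatedCube.IsFlag (S.Δ Q) ∧
      TwoTruncatedCube.IsGammaPolynomial Q.1 (TwoTruncatedCube.fPolynomial (S.Δ Q)) := by
  refine ⟨?_, fun m S Q => ⟨S.isGammaFamily.subset_range Q, S.isGammaFamily.isFlag Q,
    S.isGammaFamily.isGammaPolynomial Q⟩⟩
  obtain ⟨m, ⟨S⟩⟩ := hP
  let top : TwoTruncatedCube.Face P.carrier := ⟨P.carrier, P.nonempty, IsExposed.refl P.carrier⟩
  exact ⟨S.Δ top, S.isGammaFamily.finite_faces top, S.isGammaFamily.isFlag top,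
    S.isGammaFamily.isGammaPolynomial top⟩

theorem mainTheorem1 {E : Type*} [NormedAddCommGroup E] [NormedSpace ℝ E]
    [FiniteDimensional ℝ E] {n : ℕ} (P : TwoTruncatedCube.ConvexPolytope E n)
    (hP : TwoTruncatedCube.IsTwoTruncatedCube P) :
    (∃ Δ : PreAbstractSimplicialComplex ℕ, Δ.faces.Finite ∧ TwoTruncatedCube.IsFlag Δ ∧
      TwoTruncatedCube.IsGammaPolynomial P.carrier (TwoTruncatedCube.fPolynomial Δ)) ∧
    ∀ (m : ℕ) (S : TwoTruncatedCube.TruncationSequence P m)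
      (Q : TwoTruncatedCube.Face P.carrier),
      (∀ s ∈ (S.Δ Q).faces, s ⊆ Finset.range m) ∧
      TwoTruncatedCube.IsFlag (S.Δ Q) ∧
      TwoTruncatedCube.IsGammaPolynomial Q.1 (TwoTruncatedCube.fPolynomial (S.Δ Q)) :=
  mainTheorem1_general P hP
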